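/- Let $(V,R)$ be an irreducible (crystallographic) finite root system, reduced or not, with $R\subset V^*$, where $V$ is a real euclidean space; let $\Delta_0\subset R$ be a basis and $\theta\in R$ the highest root with respect to $\Delta_0$. Put $R_{\mathrm{red}}=R\setminus 2R$ and $E=V$, and let $$S=\{\alpha+n:\alpha\in R_{\mathrm{red}},\,n\in\mathbb Z\}\sqcup\{\alpha+2m+1:\alpha\in R\cap 2R,\,m\in\mathbb Z\}$$ be the affinisation, a set of affine functions on $E$, with basis $\Delta=\Delta_0\cup\{1-\theta\}$ and positive roots $S^+=S\cap\mathbb N\Delta$. For $a=\alpha+n\in S$ put $\partial a=\alpha$ and $s_a(x)=x-a(x)\alpha^\vee$, and let $W_S$ be the group of transformations of $E$ generated by all $s_a$, $a\in S$; it acts on affine functions by $(wa)(x)=a(w^{-1}x)$. Fix $\lambda_0\in E$. Let $\omega=\{\omega_\lambda\}_{\lambda\in W_S\lambda_0}$ be a family of order functions, that is, of functions $\omega_\lambda:S^+\to\mathbb Z_{\ge -1}$ such that: (i) $\omega_\lambda(a)=-1$ implies $a(\lambda)=0$; (ii) $\omega_\lambda(a)=\omega_{w\lambda}(wa)$ whenever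 $w\in W_S$ and $a,wa\in S^+$; (iii) the extension $\tilde\omega_\lambda$ of $\omega_\lambda$ to $S$, given by $\tilde\omega_\lambda(a)=\omega_{w\lambda}(wa)$ for any $w\in W_S$ with $wa\in S^+$, has finite support. Let $\mathbb C[V]$ be the algebra of complex polynomial functions on $V$, let $\mathrm{Pol}=\bigoplus_{\lambda\in W_S\lambda_0}\mathbb C[V]$, and let $\mathbf e(\lambda)$ be the projector of $\mathrm{Pol}$ onto its $\lambda$-th factor. The algebra $\mathbb C[V]$ acts on $\mathrm{Pol}$ by diagonal multiplication, and on $\mathrm{End}_{\mathbb C}(\mathrm{Pol})$ by left multiplication. For $a\in\Delta$ let $\tau^\omega_a\in\mathrm{End}_{\mathbb C}(\mathrm{Pol})$ be the operator which maps the $\lambda$-th factor to the $s_a\lambda$-th factor by $(\partial a)^{-1}(s_{\partial a}-1)$ if $\omega_\lambda(a)=-1$ and by $(\partial a)^{\omega_\lambda(a)}s_{\partial a}$ if $\omega_\lambda(a)\ge 0$. The quiver double Hecke algebra $\mathbf A^\omega$ is the (non-unital) subalgebra of $\mathrm{End}_{\mathbb C}(\mathrm{Pol})$ generated by all $f\,\mathbf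 e(\lambda)$ and $\tau^\omega_a\mathbf e(\lambda)$ with $f\in\mathbb C[V]$, $a\in\Delta$, $\lambda\in W_S\lambda_0$. **Theorem.** For each $w\in W_S$ choose a reduced expression $w=s_{a_l}\cdots s_{a_1}$ with $a_i\in\Delta$, and put $\tau^\omega_w=\tau^\omega_{a_l}\cdots\tau^\omega_{a_1}$. Then $$\mathbf A^\omega=\bigoplus_{\lambda\in W_S\lambda_0}\ \bigoplus_{w\in W_S}\mathbb C[V]\,\tau^\omega_w\mathbf e(\lambda),$$ where each summand is free of rank one over $\mathbb C[V]$; that is, the elements $\tau^\omega_w\mathbf e(\lambda)$, $(\lambda,w)\in W_S\lambda_0\times W_S$, form a basis of $\mathbf A^\omega$ as a left $\mathbb C[V]$-module. -/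

import Mathlib

open scoped TensorProduct

noncomputable section

namespace QDHA

/-- The algebra `ℂ[V]` of complex polynomial functions on the real vector space `V`, as the symmetric
algebra of the complexification of the dual space `M = V^*`. -/
abbrev PolyFun (M : Type*) [AddCommGroup M] [Module ℝ M] : Type _ :=
  SymmetricAlgebra ℂ (ℂ ⊗[ℝ] M)

section Basic

variable {ι M N : Type*} [AddCommGroup M] [Module ℝ M] [AddCommGroup N] [Module ℝ N]
variable (P : RootPairing ι ℝ M N)

/-! ### The affinisation of a finite root system

`P` is a finite root system with roots in `M = V^*` and coroots in `N = V`. The affine space is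
`E = V = N`. The affine function `α + n` with `α = P.root i` and `n ∈ ℤ` is encoded by the pair
`(i, n)`. -/

/-- The value at `x ∈ E` of the affine function `α + n` encoded by `a = (i, n)`. -/
def affEval (a : ι × ℤ) (x : N) : ℝ := P.root' a.1 x + (a.2 : ℝ)

/-- The affine function `α + n`, as the vector `(α, n)` of `V^* ⊕ ℤ`. -/
def affVec (a : ι × ℤ) : M × ℤ := (P.root a.1, a.2)

/-- The affine root system `S`: the functions `α + n` with `α ∈ R \ 2R`, `n ∈ ℤ`, together with the
functions `α + 2m + 1` with `α ∈ R ∩ 2R`, `m ∈ ℤ`. -/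
def affineRoots : Set (ι × ℤ) :=
  {a | (∀ j, P.root a.1 ≠ (2 : ℝ) • P.root j) ∨
    ((∃ j, P.root a.1 = (2 : ℝ) • P.root j) ∧ ∃ m : ℤ, a.2 = 2 * m + 1)}

/-- The reflection `s_a : E → E`, `s_a(x) = x - a(x) α^∨`, for the affine function `a = α + n`. -/
def affRefl (a : ι × ℤ) : Equiv.Perm N where
  toFun x := x - affEval P a x • P.coroot a.1
  invFun x := x - affEval P a x • P.coroot a.1
  left_inv x := by
    have h : P.root' a.1 (P.coroot a.1) = 2 := by simp
    simp only [affEval, map_sub, map_smul, h, smul_eq_mul]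
    module
  right_inv x := by
    have h : P.root' a.1 (P.coroot a.1) = 2 := by simp
    simp only [affEval, map_sub, map_smul, h, smul_eq_mul]
    module

/-- The affine Weyl group `W_S`, the group of transformations of `E` generated by the `s_a` with
`a ∈ S`. -/
def affineWeyl : Subgroup (Equiv.Perm N) :=
  Subgroup.closure (affRefl P '' affineRoots P)

/-- The orbit `W_S λ₀ ⊆ E`. -/
abbrev Orbit (lam0 : N) : Type _ := MulAction.orbit (affineWeyl P) lam0

/-- A basis `Δ₀` of the finite root system, given by the indices of its elements. The root system
may be non-reduced, so no condition is imposed on coroots. -/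
structure SimpleSystem where
  /-- the indices of the simple roots -/
  simple : Set ι
  linearIndepOn : LinearIndepOn ℝ P.root simple
  mem_or_neg_mem : ∀ i, P.root i ∈ AddSubmonoid.closure (P.root '' simple) ∨
    -P.root i ∈ AddSubmonoid.closure (P.root '' simple)

variable {P}

namespace SimpleSystem

variable (b : SimpleSystem P)

/-- `θ` is the highest root: `θ - α` is a sum of simple roots for every root `α`. -/
def IsHighest (θ : ι) : Prop :=
  ∀ i, P.root θ - P.root i ∈ AddSubmonoid.closure (P.root '' b.simple)

/-- The basis `Δ = Δ₀ ∪ {1 - θ}` of `S`. -/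
def affSimple (θ : ι) : Set (ι × ℤ) :=
  {a | (a.1 ∈ b.simple ∧ a.2 = 0) ∨ (P.root a.1 = -P.root θ ∧ a.2 = 1)}

/-- The positive affine roots `S⁺ = S ∩ ℕΔ`. -/
def affPos (θ : ι) : Set (ι × ℤ) :=
  {a ∈ affineRoots P | affVec P a ∈ AddSubmonoid.closure (affVec P '' b.affSimple θ)}

/-- A simple root is never twice a root. -/
lemma simple_ne_two_smul {i : ι} (hi : i ∈ b.simple) (j : ι) :
    P.root i ≠ (2 : ℝ) • P.root j := by
  intro h
  classical
  have hli : LinearIndependent ℝ (fun k : b.simple => P.root k) := b.linearIndepOn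
  obtain ⟨f, hf⟩ : ∃ f : M →ₗ[ℝ] ℝ, ∀ k : b.simple, f (P.root k) = if (k : ι) = i then 1 else 0 := by
    let B := Module.Basis.span hli
    obtain ⟨f, hf⟩ := LinearMap.exists_extend
      (B.constr ℝ (fun k : b.simple => if (k : ι) = i then (1 : ℝ) else 0))
    refine ⟨f, fun k => ?_⟩
    have h1 : f (P.root k) = (f ∘ₗ Submodule.subtype _) (B k) := by
      rw [LinearMap.comp_apply, Submodule.subtype_apply, Module.Basis.span_apply hli k]
    rw [h1, hf, Module.Basis.constr_basis]
  have hnat : ∀ v ∈ AddSubmonoid.closure (P.root '' b.simple), ∃ n : ℕ, f v = n := by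
    intro v hv
    induction hv using AddSubmonoid.closure_induction with
    | mem x hx =>
      obtain ⟨k, hk, rfl⟩ := hx
      rw [hf ⟨k, hk⟩]
      split_ifs
      · exact ⟨1, by simp⟩
      · exact ⟨0, by simp⟩
    | zero => exact ⟨0, by simp⟩
    | add x y _ _ hx hy =>
      obtain ⟨n, hn⟩ := hx
      obtain ⟨m, hm⟩ := hy
      exact ⟨n + m, by simp [hn, hm]⟩
  have h1 : f (P.root i) = 1 := by simpa using hf ⟨i, hi⟩
  have h2 : (1 : ℝ) = 2 * f (P.root j) := by rw [← h1, h, map_smul, smul_eq_mul]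
  rcases b.mem_or_neg_mem j with hj | hj
  · obtain ⟨n, hn⟩ := hnat _ hj
    rw [hn] at h2
    have h3 : 1 = 2 * n := by exact_mod_cast h2
    omega
  · obtain ⟨n, hn⟩ := hnat _ hj
    rw [map_neg] at hn
    have h4 : (1 : ℝ) = -(2 * n) := by rw [← hn]; linarith
    have h3 : (1 : ℤ) = -(2 * n) := by exact_mod_cast h4
    omega

lemma affSimple_subset (θ : ι) : b.affSimple θ ⊆ affineRoots P := by
  rintro ⟨i, n⟩ (⟨hi, -⟩ | ⟨-, hn⟩)
  · exact Or.inl (fun j => b.simple_ne_two_smul hi j)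
  · by_cases h : ∃ j, P.root i = (2 : ℝ) • P.root j
    · exact Or.inr ⟨h, 0, by simpa using hn⟩
    · push Not at h
      exact Or.inl h

/-- The simple reflection `s_a`, `a ∈ Δ`, as an element of `W_S`. -/
def simpleRefl (θ : ι) (a : b.affSimple θ) : affineWeyl P :=
  ⟨affRefl P a, Subgroup.subset_closure ⟨a, b.affSimple_subset θ a.2, rfl⟩⟩

/-- The list `[a_l, …, a_1]` of elements of `Δ` is a reduced expression `w = s_{a_l} ⋯ s_{a_1}`,
i.e. an expression of `w` as a product of simple reflections of minimal length. -/
def IsReducedWord (θ : ι) (L : List (b.affSimple θ)) (w : affineWeyl P) : Prop :=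
  (L.map (b.simpleRefl θ)).prod = w ∧
    ∀ L' : List (b.affSimple θ), (L'.map (b.simpleRefl θ)).prod = w → L.length ≤ L'.length

/-- Families of order functions `ω_λ : S⁺ → ℤ_{≥ -1}`, `λ ∈ W_S λ₀`. Only the values on `S⁺` matter.
For `w ∈ W_S` and affine roots `a`, `c`, the equation `c = w a` says that `c (w x) = a x` for all
`x ∈ E`. -/
structure IsOrderFamily (θ : ι) (lam0 : N) (ω : Orbit P lam0 → ι × ℤ → ℤ) : Prop where
  neg_one_le : ∀ lam, ∀ a ∈ b.affPos θ, -1 ≤ ω lam a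
  eval_eq_zero : ∀ lam, ∀ a ∈ b.affPos θ, ω lam a = -1 → affEval P a (lam : N) = 0
  equivariant : ∀ lam (w : affineWeyl P), ∀ a ∈ b.affPos θ, ∀ c ∈ b.affPos θ,
    (∀ x : N, affEval P c (w • x) = affEval P a x) → ω (w • lam) c = ω lam a
  /-- the extension of `ω_λ` to `S`, which sends `a` to `ω_{wλ}(wa)` for any `w ∈ W_S` such that
  `wa ∈ S⁺`, has finite support -/
  finite_support : ∀ lam, {a ∈ affineRoots P | ∃ w : affineWeyl P, ∃ c ∈ b.affPos θ,
    (∀ x : N, affEval P c (w • x) = affEval P a x) ∧ ω (w • lam) c ≠ 0}.Finite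

end SimpleSystem

/-! ### Reflections and Demazure operators on `ℂ[V]` -/

variable (P)

/-- The root `α = P.root i`, as a linear function in `ℂ[V]`. -/
def rootPoly (i : ι) : PolyFun M := SymmetricAlgebra.ι ℂ (ℂ ⊗[ℝ] M) (1 ⊗ₜ P.root i)

/-- The action of the reflection `s_α` on `ℂ[V]`, induced by `β ↦ β - ⟨β, α^∨⟩ α` on `V^*`. -/
def reflPoly (i : ι) : PolyFun M →ₐ[ℂ] PolyFun M :=
  SymmetricAlgebra.lift (SymmetricAlgebra.ι ℂ (ℂ ⊗[ℝ] M) ∘ₗ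
    (P.reflection i : M →ₗ[ℝ] M).baseChange ℂ)

lemma rootPoly_dvd (i : ι) (f : PolyFun M) : rootPoly P i ∣ reflPoly P i f - f := by
  induction f using SymmetricAlgebra.induction with
  | algebraMap r => simp
  | ι x =>
    induction x using TensorProduct.induction_on with
    | zero => simp
    | tmul z m =>
      have h : (reflPoly P i) (SymmetricAlgebra.ι ℂ (ℂ ⊗[ℝ] M) (z ⊗ₜ m)) -
          SymmetricAlgebra.ι ℂ (ℂ ⊗[ℝ] M) (z ⊗ₜ m) =
          (-(((P.toLinearMap m (P.coroot i) : ℝ) : ℂ) * z)) • rootPoly P i := by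
        have h2 : P.reflection i m - m = -(P.toLinearMap m (P.coroot i)) • P.root i := by
          rw [P.reflection_apply]; simp
        have h3 : (z ⊗ₜ[ℝ] (P.reflection i m) : ℂ ⊗[ℝ] M) - z ⊗ₜ m =
            (-(((P.toLinearMap m (P.coroot i) : ℝ) : ℂ) * z)) • ((1 : ℂ) ⊗ₜ[ℝ] P.root i) := by
          rw [← TensorProduct.tmul_sub, h2, TensorProduct.tmul_smul, TensorProduct.smul_tmul',
            TensorProduct.smul_tmul']
          congr 1
          simp
        rw [rootPoly, ← map_smul, ← h3, map_sub]
        simp [reflPoly]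
      rw [h, Algebra.smul_def]
      exact Dvd.intro_left _ rfl
    | add x y hx hy =>
      have := dvd_add hx hy
      simp only [map_add]
      convert this using 1
      ring
  | mul f g hf hg =>
    have h : reflPoly P i (f * g) - f * g =
        reflPoly P i f * (reflPoly P i g - g) + (reflPoly P i f - f) * g := by
      rw [map_mul]; ring
    rw [h]
    exact dvd_add (hg.mul_left _) (hf.mul_right _)
  | add f g hf hg =>
    have := dvd_add hf hg
    rw [map_add]
    convert this using 1
    ring

lemma rootPoly_ne_zero (i : ι) : rootPoly P i ≠ 0 := by
  intro h
  have h1 : SymmetricAlgebra.lift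
      (TensorProduct.AlgebraTensorModule.lift
        ((LinearMap.toSpanSingleton ℂ (M →ₗ[ℝ] ℂ)
          (Complex.ofRealCLM.toLinearMap ∘ₗ P.coroot' i)))) (rootPoly P i) = (2 : ℂ) := by
    rw [rootPoly, SymmetricAlgebra.lift_ι_apply]
    simp
  rw [h, map_zero] at h1
  norm_num at h1

/-- The Demazure operator `f ↦ α⁻¹ (s_α(f) - f)` on `ℂ[V]`. -/
def demazure (i : ι) : PolyFun M →ₗ[ℂ] PolyFun M where
  toFun f := (rootPoly_dvd P i f).choose
  map_add' f g := by
    apply mul_left_cancel₀ (rootPoly_ne_zero P i)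
    rw [mul_add, ← (rootPoly_dvd P i (f + g)).choose_spec, ← (rootPoly_dvd P i f).choose_spec,
      ← (rootPoly_dvd P i g).choose_spec, map_add]
    ring
  map_smul' c f := by
    apply mul_left_cancel₀ (rootPoly_ne_zero P i)
    rw [RingHom.id_apply, mul_smul_comm, ← (rootPoly_dvd P i (c • f)).choose_spec,
      ← (rootPoly_dvd P i f).choose_spec, map_smul, smul_sub]

/-- The defining property of the Demazure operator. -/
lemma rootPoly_mul_demazure (i : ι) (f : PolyFun M) :
    rootPoly P i * demazure P i f = reflPoly P i f - f :=
  (rootPoly_dvd P i f).choose_spec.symm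

/-- For `α = P.root i`, the operator `α⁻¹ (s_α - 1)` on `ℂ[V]` if `k = -1`, and `α^k s_α` if `k ≥ 0`
(the only values of `k` which are used are the integers `k ≥ -1`). -/
def tauPoly (i : ι) (k : ℤ) : PolyFun M →ₗ[ℂ] PolyFun M :=
  if k = -1 then demazure P i
  else LinearMap.mulLeft ℂ (rootPoly P i ^ k.toNat) ∘ₗ (reflPoly P i).toLinearMap

/-! ### The quiver double Hecke algebra -/

/-- The polynomial module `Pol = ⨁_{λ ∈ W_S λ₀} ℂ[V]`. -/
abbrev Pol (lam0 : N) : Type _ := Orbit P lam0 →₀ PolyFun M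

/-- The projector `e(λ)` of `Pol` onto its factor of index `λ`. -/
def idem {lam0 : N} (lam : Orbit P lam0) : Module.End ℂ (Pol P lam0) :=
  Finsupp.lsingle lam ∘ₗ Finsupp.lapply lam

variable {P}

namespace SimpleSystem

variable (b : SimpleSystem P)

/-- The operator `τ^ω_a` on `Pol`, for `a ∈ Δ`; it maps the factor of index `λ` to the factor of index
`s_a λ`, through `(∂a)⁻¹ (s_{∂a} - 1)` if `ω_λ(a) = -1` and through `(∂a)^{ω_λ(a)} s_{∂a}` if
`ω_λ(a) ≥ 0`. -/
def tau (θ : ι) {lam0 : N} (ω : Orbit P lam0 → ι × ℤ → ℤ) (a : b.affSimple θ) :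
    Module.End ℂ (Pol P lam0) :=
  Finsupp.lsum ℂ fun lam : Orbit P lam0 =>
    Finsupp.lsingle (b.simpleRefl θ a • lam) ∘ₗ tauPoly P a.1.1 (ω lam a)

/-- The operator `τ^ω_{a_l} ⋯ τ^ω_{a_1}` attached to the word `[a_l, …, a_1]`. -/
def tauWord (θ : ι) {lam0 : N} (ω : Orbit P lam0 → ι × ℤ → ℤ) (L : List (b.affSimple θ)) :
    Module.End ℂ (Pol P lam0) :=
  (L.map (b.tau θ ω)).prod

/-- The quiver double Hecke algebra `A^ω`: the (non-unital) algebra of operators on `Pol` generated by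
the `f e(λ)` and the `τ^ω_a e(λ)`, for `f ∈ ℂ[V]`, `λ ∈ W_S λ₀` and `a ∈ Δ`. The scalar multiplication
by `f ∈ ℂ[V]` on operators is the composition with the diagonal multiplication by `f` on `Pol`. -/
def quiverDoubleHecke (θ : ι) {lam0 : N} (ω : Orbit P lam0 → ι × ℤ → ℤ) :
    NonUnitalSubalgebra ℂ (Module.End ℂ (Pol P lam0)) :=
  NonUnitalAlgebra.adjoin ℂ
    ({T | ∃ (f : PolyFun M) (lam : Orbit P lam0), T = f • idem P lam} ∪
      {T | ∃ (a : b.affSimple θ) (lam : Orbit P lam0), T = b.tau θ ω a * idem P lam})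

end SimpleSystem

end Basic

end QDHA

end

noncomputable section

namespace QDHA

variable {ι M N : Type*} [AddCommGroup M] [Module ℝ M] [AddCommGroup N] [Module ℝ N]

/-! ### Affine roots, their reflections and the action of `W_S` on them -/

section Affine

variable (P : RootPairing ι ℝ M N)

/-! An operator with source the factor `λ` is written `∑ z ∘ T z`, where `z ∈ W_S` acts through its
linear part and moves the factor `λ` to `zλ`, and the `T z` are rational functions on `V`. The
family `T` is determined by the operator: `z` is known from its linear part and from `zλ`, so the
independence of characters applies (`eq_zero_of_coeffEval_eq_zero`). For a reduced word of `w`, the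
family of `τ_w` is supported on `w` and on shorter elements, and its coefficient at `w` is, up to
sign, the product of the `c ^ ω_λ(c)` over the inversions `c` of `w` (`wordCoeff_support`,
`wordCoeff_leading`). Linear independence follows by triangularity.

Spanning does not go through braid relations. It uses conditions on `T` along each root hyperplane
(`IsAdmissible`). Let `ν(z)` be the order of the leading coefficient of `τ_z` along the hyperplane
(`invSum`). If no positive affine root `e` parallel to it has `ω_λ(e) = -1`, then `T z` must vanish
to order at least `ν(z)`. Otherwise `e` is unique and `s_e` fixes `λ`; for `ye > 0`, the order of `T
(y s_e)` is at least `ν(y s_e)` and `ν(y) - 1`, and `T y` agrees with `± T (y s_e)` modulo order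
`ν(y)`. This is the cancellation of poles in a Demazure operator.

These conditions hold for the identity and survive left multiplication by the generators; the case
of `τ_a` is the heart of the proof (`IsAdmissible.tauCoeff`). At an element `z` of maximal length in
the support they force order at least `ν(z)` in every direction
(`IsAdmissible.mem_locOrd_of_maximal`), so `T z` is a polynomial multiple of the leading coefficient
of `τ_z`. Subtracting that multiple of `τ_z` and inducting on length gives the span
(`exists_mem_wordSpan`). -/

lemma root_eq_of_root'_eq_smul {i j : ι} {r : ℝ} (h : ∀ x, P.root' j x = r * P.root' i x) :
    P.root j = r • P.root i := by
  apply P.toPerfPair.injective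
  ext x
  simpa using h x

variable {P} in
lemma affEval_injective {a c : ι × ℤ} (h : ∀ x, affEval P a x = affEval P c x) : a = c := by
  have h0 : a.2 = c.2 := by simpa [affEval] using h 0
  have h1 : P.root a.1 = (1 : ℝ) • P.root c.1 :=
    root_eq_of_root'_eq_smul P fun x => by simpa [affEval, h0] using h x
  exact Prod.ext (P.root.injective (by simpa using h1)) h0

lemma root'_reflectionPerm (i j : ι) (x : N) :
    P.root' (P.reflectionPerm i j) x = P.root' j x - P.pairing j i * P.root' i x := by
  rw [RootPairing.root', P.root_reflectionPerm, P.reflection_apply_root]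
  simp

/-- The affine root `-a`. -/
def negRoot (a : ι × ℤ) : ι × ℤ := (P.reflectionPerm a.1 a.1, -a.2)

@[simp] lemma affEval_negRoot (a : ι × ℤ) (x : N) :
    affEval P (negRoot P a) x = -affEval P a x := by
  simp only [affEval, negRoot, root'_reflectionPerm, P.pairing_same, Int.cast_neg]
  ring

lemma eq_negRoot {a c : ι × ℤ} (h : ∀ x, affEval P c x = -affEval P a x) : c = negRoot P a :=
  affEval_injective (P := P) fun x => by rw [h, affEval_negRoot]

@[simp] lemma negRoot_negRoot (a : ι × ℤ) : negRoot P (negRoot P a) = a :=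
  affEval_injective (P := P) fun x => by simp

lemma root_negRoot (a : ι × ℤ) : P.root (negRoot P a).1 = -P.root a.1 := by
  simp [negRoot, P.root_reflectionPerm]

lemma affRefl_apply (a : ι × ℤ) (x : N) :
    affRefl P a x = x - affEval P a x • P.coroot a.1 := rfl

lemma affRefl_affRefl (a : ι × ℤ) (x : N) : affRefl P a (affRefl P a x) = x :=
  (affRefl P a).left_inv x

lemma affRefl_mul_self (a : ι × ℤ) : affRefl P a * affRefl P a = 1 :=
  Equiv.ext fun x => affRefl_affRefl P a x

lemma affRefl_inv (a : ι × ℤ) : (affRefl P a)⁻¹ = affRefl P a :=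
  inv_eq_of_mul_eq_one_left (affRefl_mul_self P a)

@[simp] lemma affEval_affRefl_self (a : ι × ℤ) (x : N) :
    affEval P a (affRefl P a x) = -affEval P a x := by
  simp [affRefl_apply, affEval]
  ring

lemma affRefl_of_affEval_eq_zero {a : ι × ℤ} {x : N} (h : affEval P a x = 0) :
    affRefl P a x = x := by simp [affRefl_apply, h]

lemma affRefl_negRoot (a : ι × ℤ) : affRefl P (negRoot P a) = affRefl P a := by
  ext x
  simp only [affRefl_apply, affEval_negRoot]
  simp [negRoot, P.coroot_reflectionPerm]

/-- The reflection `s_e`, `e ∈ S`, as an element of `W_S`. -/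
def weylRefl (e : affineRoots P) : affineWeyl P :=
  ⟨affRefl P e, Subgroup.subset_closure ⟨e, e.2, rfl⟩⟩

lemma weylRefl_smul (e : affineRoots P) (x : N) : weylRefl P e • x = affRefl P e x := rfl

@[simp] lemma weylRefl_mul_self (e : affineRoots P) : weylRefl P e * weylRefl P e = 1 :=
  Subtype.ext (affRefl_mul_self P e)

@[simp] lemma weylRefl_inv (e : affineRoots P) : (weylRefl P e)⁻¹ = weylRefl P e :=
  inv_eq_of_mul_eq_one_left (weylRefl_mul_self P e)

/-- The linear part of `z` is described through its contragredient on `V^*`; subtracting `z • 0`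
removes the translation. -/
lemma exists_smul_eq (z : affineWeyl P) :
    ∃ φ : M ≃ₗ[ℝ] M, (∀ m x, P.toLinearMap (φ m) (z • x - z • (0 : N)) = P.toLinearMap m x) := by
  obtain ⟨z, hz⟩ := z
  simp only [Subgroup.smul_def, Equiv.Perm.smul_def]
  induction hz using Subgroup.closure_induction with
  | mem w hw =>
    obtain ⟨c, -, rfl⟩ := hw
    refine ⟨P.reflection c.1, fun m x => ?_⟩
    simp only [affRefl_apply, affEval, P.reflection_apply, map_sub, map_smul, map_zero,
      LinearMap.sub_apply, LinearMap.smul_apply, smul_eq_mul, P.root'_coroot_eq_pairing,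
      P.pairing_same, LinearMap.flip_apply]
    ring
  | one => exact ⟨LinearEquiv.refl ℝ M, fun m x => by simp⟩
  | mul w v _ _ hw hv =>
    obtain ⟨φ, hφ⟩ := hw
    obtain ⟨ψ, hψ⟩ := hv
    refine ⟨ψ.trans φ, fun m x => ?_⟩
    have h : (w * v) x - (w * v) 0 = (w (v x) - w 0) - (w (v 0) - w 0) := by
      simp [Equiv.Perm.mul_apply]
    rw [h, map_sub, LinearEquiv.trans_apply, hφ, hφ, ← map_sub, hψ]
  | inv w _ hw =>
    obtain ⟨φ, hφ⟩ := hw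
    refine ⟨φ.symm, fun m x => ?_⟩
    have h1 := hφ (φ.symm m) (w⁻¹ x)
    have h2 := hφ (φ.symm m) (w⁻¹ 0)
    have h3 : ∀ y, w (w⁻¹ y) = y := fun y => by rw [← Equiv.Perm.mul_apply, mul_inv_cancel]; rfl
    rw [map_sub, ← h1, ← h2, φ.apply_symm_apply, h3, h3]
    simp

section Crystallographic

variable [P.IsCrystallographic]

/-- The affine root `s_c a`. -/
def reflRoot (c a : ι × ℤ) : ι × ℤ :=
  (P.reflectionPerm c.1 a.1, a.2 - c.2 * P.pairingIn ℤ a.1 c.1)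

lemma affEval_reflRoot (c a : ι × ℤ) (x : N) :
    affEval P (reflRoot P c a) x = affEval P a (affRefl P c x) := by
  have h : P.pairing a.1 c.1 = (P.pairingIn ℤ a.1 c.1 : ℝ) := by
    simpa using (P.algebraMap_pairingIn ℤ a.1 c.1).symm
  simp only [affEval, reflRoot, root'_reflectionPerm, affRefl_apply, map_sub, map_smul,
    smul_eq_mul, P.root'_coroot_eq_pairing, h, Int.cast_sub, Int.cast_mul]
  ring

lemma reflRoot_mem (c : ι × ℤ) {a : ι × ℤ} (ha : a ∈ affineRoots P) :
    reflRoot P c a ∈ affineRoots P := by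
  rcases ha with ha | ⟨⟨j, hj⟩, m, hm⟩
  · left
    intro j hj
    apply ha (P.reflectionPerm c.1 j)
    have := congrArg (P.reflection c.1) hj
    simpa [reflRoot, P.root_reflectionPerm] using this
  · right
    refine ⟨⟨P.reflectionPerm c.1 j, by simp [reflRoot, P.root_reflectionPerm, hj]⟩, ?_⟩
    -- The pairing of `2β` with a coroot is even, so the constant term stays odd.
    have h : P.pairingIn ℤ a.1 c.1 = 2 * P.pairingIn ℤ j c.1 := by
      have : P.pairing a.1 c.1 = 2 * P.pairing j c.1 := by
        simp only [← P.root_coroot_eq_pairing, hj, map_smul, LinearMap.smul_apply, smul_eq_mul]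
      simp only [← P.algebraMap_pairingIn ℤ, eq_intCast] at this
      exact_mod_cast this
    refine ⟨m - c.2 * P.pairingIn ℤ j c.1, ?_⟩
    simp only [reflRoot, h, hm]
    ring

lemma negRoot_eq_reflRoot (a : ι × ℤ) : negRoot P a = reflRoot P a a :=
  affEval_injective (P := P) fun x => by simp [affEval_reflRoot]

lemma negRoot_mem {a : ι × ℤ} (ha : a ∈ affineRoots P) : negRoot P a ∈ affineRoots P :=
  negRoot_eq_reflRoot P a ▸ reflRoot_mem P a ha

lemma exists_actRoot (z : affineWeyl P) (a : ι × ℤ) :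
    ∃ c, (∀ x, affEval P c (z • x) = affEval P a x) ∧
      (a ∈ affineRoots P → c ∈ affineRoots P) := by
  let Q : Equiv.Perm N → Prop := fun w => ∀ a, ∃ c,
    (∀ x, affEval P c (w x) = affEval P a x) ∧ (a ∈ affineRoots P → c ∈ affineRoots P)
  have hmul : ∀ w v, Q w → Q v → Q (w * v) := fun w v hw hv a => by
    obtain ⟨c, hc, hc'⟩ := hv a
    obtain ⟨d, hd, hd'⟩ := hw c
    exact ⟨d, fun x => by rw [Equiv.Perm.mul_apply, hd, hc], fun ha => hd' (hc' ha)⟩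
  -- Carrying `z` and its inverse together makes the inverse step of the closure induction a swap.
  suffices h : Q z ∧ Q (z : Equiv.Perm N)⁻¹ from h.1 a
  obtain ⟨z, hz⟩ := z
  dsimp only
  clear a
  induction hz using Subgroup.closure_induction with
  | mem w hw =>
    obtain ⟨c, -, rfl⟩ := hw
    rw [affRefl_inv, and_self]
    exact fun a => ⟨reflRoot P c a, fun x => by rw [affEval_reflRoot, affRefl_affRefl],
      fun ha => reflRoot_mem P c ha⟩
  | one =>
    rw [inv_one, and_self]
    exact fun a => ⟨a, fun x => rfl, id⟩
  | mul w v _ _ hw hv => exact ⟨hmul _ _ hw.1 hv.1, mul_inv_rev w v ▸ hmul _ _ hv.2 hw.2⟩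
  | inv w _ hw => exact ⟨hw.2, (inv_inv w).symm ▸ hw.1⟩

/-- The affine root `z a`, for `z ∈ W_S`. -/
def actRoot (z : affineWeyl P) (a : ι × ℤ) : ι × ℤ := (exists_actRoot P z a).choose

@[simp] lemma affEval_actRoot (z : affineWeyl P) (a : ι × ℤ) (x : N) :
    affEval P (actRoot P z a) (z • x) = affEval P a x :=
  (exists_actRoot P z a).choose_spec.1 x

lemma affEval_actRoot' (z : affineWeyl P) (a : ι × ℤ) (x : N) :
    affEval P (actRoot P z a) x = affEval P a (z⁻¹ • x) := by
  conv_lhs => rw [← smul_inv_smul z x, affEval_actRoot]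

lemma actRoot_mem (z : affineWeyl P) {a : ι × ℤ} (ha : a ∈ affineRoots P) :
    actRoot P z a ∈ affineRoots P :=
  (exists_actRoot P z a).choose_spec.2 ha

variable {P} in
lemma eq_actRoot {z : affineWeyl P} {a c : ι × ℤ}
    (h : ∀ x, affEval P c (z • x) = affEval P a x) : c = actRoot P z a :=
  affEval_injective (P := P) fun x => by rw [affEval_actRoot', ← h, smul_inv_smul]

@[simp] lemma actRoot_one (a : ι × ℤ) : actRoot P 1 a = a :=
  (eq_actRoot fun x => by rw [one_smul]).symm

lemma actRoot_mul (z w : affineWeyl P) (a : ι × ℤ) :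
    actRoot P (z * w) a = actRoot P z (actRoot P w a) :=
  (eq_actRoot fun x => by rw [mul_smul, affEval_actRoot, affEval_actRoot]).symm

@[simp] lemma actRoot_actRoot_inv (z : affineWeyl P) (a : ι × ℤ) :
    actRoot P z (actRoot P z⁻¹ a) = a := by rw [← actRoot_mul, mul_inv_cancel, actRoot_one]

@[simp] lemma actRoot_inv_actRoot (z : affineWeyl P) (a : ι × ℤ) :
    actRoot P z⁻¹ (actRoot P z a) = a := by rw [← actRoot_mul, inv_mul_cancel, actRoot_one]

lemma actRoot_eq_iff {z : affineWeyl P} {a c : ι × ℤ} :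
    actRoot P z a = c ↔ a = actRoot P z⁻¹ c :=
  ⟨fun h => by rw [← h, actRoot_inv_actRoot], fun h => by rw [h, actRoot_actRoot_inv]⟩

lemma actRoot_negRoot (z : affineWeyl P) (a : ι × ℤ) :
    actRoot P z (negRoot P a) = negRoot P (actRoot P z a) :=
  eq_negRoot P fun x => by rw [affEval_actRoot', affEval_negRoot, affEval_actRoot']

lemma actRoot_weylRefl_self (e : affineRoots P) : actRoot P (weylRefl P e) e = negRoot P e :=
  eq_negRoot P fun x => by
    rw [affEval_actRoot', weylRefl_inv, weylRefl_smul, affEval_affRefl_self]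

end Crystallographic
end Affine
end QDHA

namespace QDHA

variable {ι M N : Type*} [AddCommGroup M] [Module ℝ M] [AddCommGroup N] [Module ℝ N]

/-! ### Conjugation of reflections, and reducedness of `S` -/

section Affine2

variable (P : RootPairing ι ℝ M N) [P.IsCrystallographic]

lemma affRefl_actRoot_smul (z : affineWeyl P) (e : ι × ℤ) (x : N) :
    affRefl P (actRoot P z e) (z • x) = z • affRefl P e x := by
  let Q : affineWeyl P → Prop := fun z => ∀ e x,
    affRefl P (actRoot P z e) (z • x) = z • affRefl P e x
  suffices h : Q z from h e x
  obtain ⟨z, hz⟩ := z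
  induction hz using Subgroup.closure_induction with
  | mem w hw =>
    obtain ⟨c, hc, rfl⟩ := hw
    intro e x
    have h1 : actRoot P (weylRefl P ⟨c, hc⟩) e = reflRoot P c e :=
      (eq_actRoot fun x => by rw [weylRefl_smul, affEval_reflRoot, affRefl_affRefl]).symm
    change affRefl P (actRoot P (weylRefl P ⟨c, hc⟩) e) (weylRefl P ⟨c, hc⟩ • x) =
      weylRefl P ⟨c, hc⟩ • affRefl P e x
    rw [h1, weylRefl_smul, weylRefl_smul]
    simp only [affRefl_apply P (reflRoot P c e), affEval_reflRoot, affRefl_affRefl]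
    simp only [reflRoot, P.coroot_reflectionPerm, affRefl_apply, affEval, map_sub, map_smul,
      smul_eq_mul, P.coreflection_apply]
    module
  | one =>
    intro e x
    change affRefl P (actRoot P 1 e) ((1 : affineWeyl P) • x) = (1 : affineWeyl P) • _
    rw [actRoot_one, one_smul, one_smul]
  | mul w v hw' hv' hw hv =>
    intro e x
    change affRefl P (actRoot P (⟨w, hw'⟩ * ⟨v, hv'⟩) e) (((⟨w, hw'⟩ * ⟨v, hv'⟩ : affineWeyl P)) • x)
      = (⟨w, hw'⟩ * ⟨v, hv'⟩ : affineWeyl P) • _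
    rw [actRoot_mul, mul_smul, hw, hv, mul_smul]
  | inv w hw' hw =>
    intro e x
    change affRefl P (actRoot P (⟨w, hw'⟩⁻¹) e) ((⟨w, hw'⟩ : affineWeyl P)⁻¹ • x)
      = (⟨w, hw'⟩ : affineWeyl P)⁻¹ • _
    have := hw (actRoot P (⟨w, hw'⟩⁻¹) e) ((⟨w, hw'⟩ : affineWeyl P)⁻¹ • x)
    rw [actRoot_actRoot_inv, smul_inv_smul] at this
    rw [this, inv_smul_smul]

lemma weylRefl_actRoot (z : affineWeyl P) (e : affineRoots P) :
    weylRefl P ⟨actRoot P z e, actRoot_mem P z e.2⟩ * z = z * weylRefl P e :=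
  Subtype.ext <| Equiv.ext fun x => affRefl_actRoot_smul P z e x

variable {P}

/-- `S` is reduced even if `R` is not. The two pairings are integers with product 4, so the ratio is
1/2, 1 or 2; a ratio other than 1 would produce an element of `R ∩ 2R` with an even constant term,
which `S` excludes. -/
lemma eq_of_root_eq_smul [Finite ι] {a c : ι × ℤ} (ha : a ∈ affineRoots P) (hc : c ∈ affineRoots P)
    {r : ℝ} (hr : 0 < r) (h : ∀ x, affEval P c x = r * affEval P a x) : c = a := by
  have h2 : (c.2 : ℝ) = r * a.2 := by simpa [affEval] using h 0
  have h1 : P.root c.1 = r • P.root a.1 :=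
    root_eq_of_root'_eq_smul P fun x => by
      have := h x
      simp only [affEval, mul_add, ← h2] at this
      simpa using this
  have h3 : P.pairing c.1 a.1 = 2 * r := by
    simp [← P.root_coroot_eq_pairing, h1, mul_comm]
  have h4 : r * P.pairing a.1 c.1 = 2 := by
    have := P.root_coroot_two c.1
    rw [h1, map_smul, LinearMap.smul_apply, smul_eq_mul] at this
    exact this
  simp only [← P.algebraMap_pairingIn ℤ, eq_intCast] at h3 h4
  set m := P.pairingIn ℤ c.1 a.1
  set n := P.pairingIn ℤ a.1 c.1
  have hmn : m * n = 4 := by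
    have : (m : ℝ) * n = 4 := by rw [h3]; linarith
    exact_mod_cast this
  have hm : 0 < m := by
    have : (0 : ℝ) < m := by rw [h3]; positivity
    exact_mod_cast this
  have hm4 : m ≤ 4 := Int.le_of_dvd (by norm_num) ⟨n, hmn.symm⟩
  have key : ∀ u v : ι × ℤ, u ∈ affineRoots P → P.root u.1 = (2 : ℝ) • P.root v.1 →
      (u.2 : ℝ) = 2 * v.2 → False := by
    intro u v hu h5 h6
    rcases hu with hu | ⟨-, k, hk⟩
    · exact hu _ h5
    · have : u.2 = 2 * v.2 := by exact_mod_cast h6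
      omega
  interval_cases m
  · exfalso
    have : r = 1 / 2 := by push_cast at h3; linarith
    subst this
    refine key a c ha ?_ ?_
    · rw [h1, smul_smul]; norm_num
    · linarith
  · have : r = 1 := by push_cast at h3; linarith
    subst this
    exact Prod.ext (P.root.injective (by simpa using h1)) (by exact_mod_cast h2.trans (one_mul _))
  · omega
  · exfalso
    have : r = 2 := by push_cast at h3; linarith
    subst this
    exact key c a hc h1 h2

end Affine2

/-! ### The fundamental alcove, its walls, and positivity -/

namespace SimpleSystem

variable {P : RootPairing ι ℝ M N} (b : SimpleSystem P) {θ : ι}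

lemma exists_root'_eq (c : ι → ℝ) : ∃ x : N, ∀ i ∈ b.simple, P.root' i x = c i := by
  have hli : LinearIndependent ℝ (fun k : b.simple => P.root k) := b.linearIndepOn
  let B := Module.Basis.span hli
  obtain ⟨f, hf⟩ := LinearMap.exists_extend (B.constr ℝ (fun k : b.simple => c k))
  refine ⟨P.toLinearMap.flip.toPerfPair.symm f, fun i hi => ?_⟩
  rw [RootPairing.root', LinearMap.apply_toPerfPair_flip]
  have h1 : f (P.root i) = (f ∘ₗ Submodule.subtype _) (B ⟨i, hi⟩) := by
    rw [LinearMap.comp_apply, Submodule.subtype_apply, Module.Basis.span_apply hli ⟨i, hi⟩]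
  rw [h1, hf, Module.Basis.constr_basis]

lemma root_highest_mem (hθ : b.IsHighest θ) : P.root θ ∈ AddSubmonoid.closure (P.root '' b.simple) := by
  rcases b.mem_or_neg_mem θ with h | h
  · exact h
  · have h2 := hθ (P.reflectionPerm θ θ)
    have := add_mem h (by simpa [P.root_reflectionPerm] using h2)
    simpa using this

lemma root'_highest_nonneg (hθ : b.IsHighest θ) {x : N} (hx : ∀ i ∈ b.simple, 0 ≤ P.root' i x) : 0 ≤ P.root' θ x := by
  have : ∀ v ∈ AddSubmonoid.closure (P.root '' b.simple), 0 ≤ P.toLinearMap v x := by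
    intro v hv
    induction hv using AddSubmonoid.closure_induction with
    | mem v hv => obtain ⟨i, hi, rfl⟩ := hv; exact hx i hi
    | zero => simp
    | add u v _ _ hu hv => simpa using add_nonneg hu hv
  exact this _ (b.root_highest_mem hθ)

lemma root'_highest_pos (hθ : b.IsHighest θ) {x : N} (hx : ∀ i ∈ b.simple, 0 < P.root' i x) : 0 < P.root' θ x := by
  have : ∀ v ∈ AddSubmonoid.closure (P.root '' b.simple), v = 0 ∨ 0 < P.toLinearMap v x := by
    intro v hv
    induction hv using AddSubmonoid.closure_induction with
    | mem v hv => obtain ⟨i, hi, rfl⟩ := hv; exact Or.inr (hx i hi)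
    | zero => simp
    | add u v _ _ hu hv =>
      rcases hu with rfl | hu
      · simpa using hv
      · rcases hv with rfl | hv
        · simpa using Or.inr hu
        · right; simpa using add_pos hu hv
  exact (this _ (b.root_highest_mem hθ)).resolve_left (P.ne_zero θ)

lemma exists_alcove_point (hθ : b.IsHighest θ) : ∃ x : N, ∀ a ∈ b.affSimple θ, 0 < affEval P a x := by
  obtain ⟨x, hx⟩ := b.exists_root'_eq (fun _ => 1)
  have hpos := b.root'_highest_pos hθ (x := x) fun i hi => by rw [hx i hi]; norm_num
  -- The scaling gives `θ` the value 1/2, hence also `1 - θ`.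
  refine ⟨(2 * P.root' θ x)⁻¹ • x, ?_⟩
  rintro ⟨i, n⟩ (⟨hi, hn⟩ | ⟨hi, hn⟩)
  · dsimp only at hi hn
    simp only [affEval, map_smul, hx i hi, hn, smul_eq_mul]
    simp [hpos]
  · dsimp only at hi hn
    simp only [affEval, RootPairing.root', map_smul, hi, hn, smul_eq_mul]
    simp only [map_neg, LinearMap.neg_apply]
    change 0 < (2 * P.root' θ x)⁻¹ * -(P.root' θ x) + _
    field_simp
    norm_num

lemma exists_wall_point (hθ : b.IsHighest θ) {a : ι × ℤ} (ha : a ∈ b.affSimple θ) :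
    ∃ x : N, affEval P a x = 0 ∧ ∀ c ∈ b.affSimple θ, c ≠ a → 0 < affEval P c x := by
  classical
  obtain ⟨i, n⟩ := a
  rcases ha with ⟨hi, hn⟩ | ⟨hi, hn⟩ <;> dsimp only at hi hn <;> subst hn
  · obtain ⟨x, hx⟩ := b.exists_root'_eq (fun j => if j = i then 0 else 1)
    have hpos := b.root'_highest_nonneg hθ (x := x) fun i hi => by
      rw [hx i hi]; split_ifs <;> norm_num
    -- `θ` may vanish at `x`, as in rank one; the `+ 1` keeps the scaling factor positive.
    refine ⟨(2 * P.root' θ x + 1)⁻¹ • x, by simp [affEval, hx i hi], ?_⟩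
    rintro ⟨j, n⟩ (⟨hj, hn⟩ | ⟨hj, hn⟩) hne <;> dsimp only at hj hn <;> subst hn
    · have : j ≠ i := fun h => hne (by rw [h])
      simp only [affEval, map_smul, hx j hj, this, if_false, smul_eq_mul]
      simp only [mul_one, Int.cast_zero, add_zero]
      positivity
    · simp only [affEval, RootPairing.root', map_smul, hj, smul_eq_mul]
      simp only [map_neg, LinearMap.neg_apply]
      change 0 < (2 * P.root' θ x + 1)⁻¹ * -(P.root' θ x) + _
      field_simp
      push_cast
      linarith
  · obtain ⟨x, hx⟩ := b.exists_root'_eq (fun _ => 1)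
    have hpos := b.root'_highest_pos hθ (x := x) fun i hi => by rw [hx i hi]; norm_num
    have h1 : ∀ j, P.root j = -P.root θ → affEval P (j, 1) ((P.root' θ x)⁻¹ • x) = 0 := by
      intro j hj
      simp only [affEval, RootPairing.root', map_smul, hj, smul_eq_mul, map_neg,
        LinearMap.neg_apply]
      change (P.root' θ x)⁻¹ * -(P.root' θ x) + _ = _
      field_simp
      push_cast
      ring
    refine ⟨(P.root' θ x)⁻¹ • x, h1 i hi, ?_⟩
    rintro ⟨j, n⟩ (⟨hj, hn⟩ | ⟨hj, hn⟩) hne <;> dsimp only at hj hn <;> subst hn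
    · simp only [affEval, map_smul, hx j hj, smul_eq_mul]
      simpa using hpos
    · exact absurd (congrArg (fun k => (k, (1 : ℤ))) (P.root.injective (hj.trans hi.symm))) hne

lemma affSimple_subset_affPos : b.affSimple θ ⊆ b.affPos θ := fun a ha =>
  ⟨b.affSimple_subset θ ha, AddSubmonoid.subset_closure ⟨a, ha, rfl⟩⟩

lemma affEval_eq_of_affVec (a : ι × ℤ) (x : N) :
    affEval P a x = P.toLinearMap (affVec P a).1 x + ((affVec P a).2 : ℝ) := rfl

lemma affEval_pos_of_mem {x : N} (hx : ∀ a ∈ b.affSimple θ, 0 < affEval P a x) {c : ι × ℤ}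
    (hc : c ∈ b.affPos θ) : 0 < affEval P c x := by
  have : ∀ v ∈ AddSubmonoid.closure (affVec P '' b.affSimple θ),
      v = 0 ∨ 0 < P.toLinearMap v.1 x + (v.2 : ℝ) := by
    intro v hv
    induction hv using AddSubmonoid.closure_induction with
    | mem v hv => obtain ⟨i, hi, rfl⟩ := hv; exact Or.inr (hx i hi)
    | zero => simp
    | add u v _ _ hu hv =>
      rcases hu with rfl | hu
      · simpa using hv
      · rcases hv with rfl | hv
        · simpa using Or.inr hu
        · right
          have := add_pos hu hv
          simp only [Prod.fst_add, Prod.snd_add, map_add, LinearMap.add_apply, Int.cast_add]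
          linarith
  refine (this _ hc.2).resolve_left fun h => P.ne_zero c.1 ?_
  exact congrArg Prod.fst h

/-- At a generic point of the wall of `a` all other simple roots are positive, so a positive root
vanishing there is a multiple of `a`, and reducedness makes it `a`. -/
lemma wall_nonneg [Finite ι] [P.IsCrystallographic] (hθ : b.IsHighest θ) {a : ι × ℤ} (ha : a ∈ b.affSimple θ) :
    ∃ x : N, affEval P a x = 0 ∧
      ∀ c ∈ b.affPos θ, 0 ≤ affEval P c x ∧ (affEval P c x = 0 → c = a) := by
  obtain ⟨x, hx0, hx⟩ := b.exists_wall_point hθ ha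
  have : ∀ v ∈ AddSubmonoid.closure (affVec P '' b.affSimple θ),
      0 ≤ P.toLinearMap v.1 x + (v.2 : ℝ) ∧ (P.toLinearMap v.1 x + (v.2 : ℝ) = 0 →
        ∃ n : ℕ, v = n • affVec P a) := by
    intro v hv
    induction hv using AddSubmonoid.closure_induction with
    | mem v hv =>
      obtain ⟨c, hc, rfl⟩ := hv
      rw [← affEval_eq_of_affVec]
      by_cases hca : c = a
      · subst hca
        exact ⟨hx0.ge, fun _ => ⟨1, by simp⟩⟩
      · exact ⟨(hx c hc hca).le, fun h => absurd h (hx c hc hca).ne'⟩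
    | zero => exact ⟨by simp, fun _ => ⟨0, by simp⟩⟩
    | add u v _ _ hu hv =>
      have e : P.toLinearMap (u + v).1 x + ((u + v).2 : ℝ) =
          (P.toLinearMap u.1 x + (u.2 : ℝ)) + (P.toLinearMap v.1 x + (v.2 : ℝ)) := by
        simp only [Prod.fst_add, Prod.snd_add, map_add, LinearMap.add_apply, Int.cast_add]
        ring
      rw [e]
      refine ⟨add_nonneg hu.1 hv.1, fun h => ?_⟩
      obtain ⟨n, hn⟩ := hu.2 (by linarith [hu.1, hv.1])
      obtain ⟨m, hm⟩ := hv.2 (by linarith [hu.1, hv.1])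
      exact ⟨n + m, by rw [hn, hm, add_smul]⟩
  refine ⟨x, hx0, fun c hc => ⟨(this _ hc.2).1, fun h => ?_⟩⟩
  obtain ⟨n, hn⟩ := (this _ hc.2).2 h
  have hn0 : n ≠ 0 := by
    rintro rfl
    exact P.ne_zero c.1 (by simpa [affVec] using congrArg Prod.fst hn)
  refine eq_of_root_eq_smul (b.affSimple_subset θ ha) hc.1 (r := n) (by positivity) fun y => ?_
  rw [affEval_eq_of_affVec, hn, affEval_eq_of_affVec]
  simp
  ring

lemma mem_affPos_or [P.IsCrystallographic] (hθ : b.IsHighest θ) {a : ι × ℤ} (ha : a ∈ affineRoots P) :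
    a ∈ b.affPos θ ∨ negRoot P a ∈ b.affPos θ := by
  have hfin : ∀ v ∈ AddSubmonoid.closure (P.root '' b.simple),
      ((v, 0) : M × ℤ) ∈ AddSubmonoid.closure (affVec P '' b.affSimple θ) := by
    intro v hv
    induction hv using AddSubmonoid.closure_induction with
    | mem v hv =>
      obtain ⟨i, hi, rfl⟩ := hv
      exact AddSubmonoid.subset_closure ⟨(i, 0), Or.inl ⟨hi, rfl⟩, rfl⟩
    | zero => exact zero_mem _
    | add u v _ _ hu hv => simpa using add_mem hu hv
  have haff : ((-P.root θ, 1) : M × ℤ) ∈ AddSubmonoid.closure (affVec P '' b.affSimple θ) :=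
    AddSubmonoid.subset_closure ⟨(P.reflectionPerm θ θ, 1), Or.inr ⟨by
      simp [P.root_reflectionPerm], rfl⟩, by simp [affVec, P.root_reflectionPerm]⟩
  have hpos : ∀ (i : ι) (n : ℕ),
      ((P.root i, (n + 1 : ℤ)) : M × ℤ) ∈ AddSubmonoid.closure (affVec P '' b.affSimple θ) := by
    intro i n
    -- The decomposition is `α + (n + 1) = (θ + α) + nθ + (n + 1)(1 - θ)`, where `θ + α` is a sum of
    -- simple roots because `θ` dominates `-α`.
    have h1 : P.root θ + P.root i ∈ AddSubmonoid.closure (P.root '' b.simple) := by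
      simpa [P.root_reflectionPerm] using hθ (P.reflectionPerm i i)
    have h2 := add_mem h1 (nsmul_mem (b.root_highest_mem hθ) n)
    have h3 := add_mem (hfin _ h2) (nsmul_mem haff (n + 1))
    convert h3 using 1
    ext
    · simp only [Prod.fst_add, Prod.smul_fst, smul_neg, add_smul, one_smul]
      abel
    · simp
  rcases lt_trichotomy a.2 0 with h | h | h
  · right
    refine ⟨negRoot_mem P ha, ?_⟩
    have := hpos (negRoot P a).1 (-a.2 - 1).toNat
    convert this using 1
    ext
    · rfl
    · simp only [affVec, negRoot]; omega
  · rcases b.mem_or_neg_mem a.1 with h' | h'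
    · exact Or.inl ⟨ha, by simpa [affVec, h] using hfin _ h'⟩
    · refine Or.inr ⟨negRoot_mem P ha, ?_⟩
      have := hfin _ h'
      rw [← root_negRoot] at this
      convert this using 1
      ext
      · rfl
      · simp [affVec, negRoot, h]
  · left
    refine ⟨ha, ?_⟩
    have := hpos a.1 (a.2 - 1).toNat
    convert this using 1
    ext
    · rfl
    · simp only [affVec]; omega

lemma negRoot_notMem_affPos (hθ : b.IsHighest θ) {a : ι × ℤ} (ha : a ∈ b.affPos θ) : negRoot P a ∉ b.affPos θ := by
  obtain ⟨x, hx⟩ := b.exists_alcove_point hθ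
  intro h
  have h1 := b.affEval_pos_of_mem hx ha
  have h2 := b.affEval_pos_of_mem hx h
  rw [affEval_negRoot] at h2
  linarith

end SimpleSystem

end QDHA

namespace QDHA

variable {ι M N : Type*} [AddCommGroup M] [Module ℝ M] [AddCommGroup N] [Module ℝ N]

/-! ### Linear parts of elements of `W_S` -/

section LinearPart

variable (P : RootPairing ι ℝ M N)

/-- The action on `V^*` of the linear part of `z ∈ W_S`. -/
def linAct (z : affineWeyl P) : M ≃ₗ[ℝ] M := (exists_smul_eq P z).choose

lemma linAct_spec (z : affineWeyl P) (m : M) (x : N) :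
    P.toLinearMap (linAct P z m) (z • x - z • (0 : N)) = P.toLinearMap m x :=
  (exists_smul_eq P z).choose_spec m x

variable {P} in
lemma eq_linAct {z : affineWeyl P} {m n : M}
    (h : ∀ x, P.toLinearMap n (z • x - z • (0 : N)) = P.toLinearMap m x) : n = linAct P z m := by
  apply P.toPerfPair.injective
  ext y
  have hy : y = z • (z⁻¹ • (y + z • (0 : N))) - z • (0 : N) := by rw [smul_inv_smul]; simp
  rw [LinearMap.toPerfPair_apply, LinearMap.toPerfPair_apply, hy, h, linAct_spec]

@[simp] lemma linAct_one (m : M) : linAct P 1 m = m :=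
  (eq_linAct fun x => by simp).symm

lemma linAct_mul (z w : affineWeyl P) (m : M) :
    linAct P (z * w) m = linAct P z (linAct P w m) :=
  (eq_linAct fun x => by
    have h : (z * w) • x - (z * w) • (0 : N) =
        (z • w • x - z • (0 : N)) - (z • w • (0 : N) - z • (0 : N)) := by
      simp [mul_smul]
    rw [h, map_sub, linAct_spec, linAct_spec, ← map_sub, linAct_spec]).symm

lemma linAct_weylRefl (e : affineRoots P) (m : M) :
    linAct P (weylRefl P e) m = P.reflection (e : ι × ℤ).1 m :=
  (eq_linAct fun x => by
    simp only [weylRefl_smul, affRefl_apply, affEval, P.reflection_apply, map_sub, map_smul,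
      map_zero, LinearMap.sub_apply, LinearMap.smul_apply, smul_eq_mul, P.root'_coroot_eq_pairing,
      P.pairing_same, LinearMap.flip_apply]
    ring).symm

lemma linAct_root [P.IsCrystallographic] (z : affineWeyl P) (e : ι × ℤ) :
    linAct P z (P.root e.1) = P.root (actRoot P z e).1 :=
  (eq_linAct fun x => by
    have h1 := affEval_actRoot P z e x
    have h2 := affEval_actRoot P z e 0
    simp only [affEval, RootPairing.root'] at h1 h2
    rw [map_zero] at h2
    rw [map_sub]
    linarith).symm

-- An affine transformation is determined by its linear part and one value. With the value taken at
-- `λ`, elements with the same `zλ` are told apart by their linear parts, as the independence of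
-- characters requires.
variable {P} in
lemma eq_of_linAct_eq {z w : affineWeyl P} {lam : N} (h : ∀ m, linAct P z m = linAct P w m)
    (hl : z • lam = w • lam) : z = w := by
  have key : ∀ x, z • x - z • lam = w • x - w • lam := fun x => by
    apply P.toLinearMap.flip.toPerfPair.injective
    ext n
    obtain ⟨m, rfl⟩ := (linAct P z).surjective n
    have e : ∀ v : affineWeyl P, P.toLinearMap (linAct P v m) (v • x - v • lam) =
        P.toLinearMap m (x - lam) := fun v => by
      rw [show v • x - v • lam = (v • x - v • (0 : N)) - (v • lam - v • (0 : N)) by abel,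
        map_sub, linAct_spec, linAct_spec, map_sub]
    change P.toLinearMap (linAct P z m) _ = P.toLinearMap (linAct P z m) _
    rw [e z, h m, e w]
  apply Subtype.ext
  ext x
  have := key x
  rw [hl] at this
  exact sub_left_injective this

end LinearPart

/-- The affine root `c` is parallel to the root `i`. -/
def Par (P : RootPairing ι ℝ M N) (i : ι) (c : ι × ℤ) : Prop := ∃ r : ℝ, P.root c.1 = r • P.root i

/-! ### Parallel affine roots -/

section Par

variable {P : RootPairing ι ℝ M N}

lemma Par.refl (c : ι × ℤ) : Par P c.1 c := ⟨1, by simp⟩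

lemma Par.negRoot {i : ι} {c : ι × ℤ} (h : Par P i c) : Par P i (negRoot P c) := by
  obtain ⟨r, hr⟩ := h
  exact ⟨-r, by rw [root_negRoot, hr, neg_smul]⟩

lemma par_negRoot_iff {i : ι} {c : ι × ℤ} : Par P i (negRoot P c) ↔ Par P i c :=
  ⟨fun h => negRoot_negRoot P c ▸ h.negRoot, Par.negRoot⟩

lemma Par.exists_smul_eq {i : ι} {c : ι × ℤ} (h : Par P i c) :
    ∃ r : ℝ, P.root i = r • P.root c.1 := by
  obtain ⟨r, hr⟩ := h
  have : r ≠ 0 := by rintro rfl; exact P.ne_zero c.1 (by simpa using hr)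
  exact ⟨r⁻¹, by rw [hr, smul_smul, inv_mul_cancel₀ this, one_smul]⟩

lemma Par.iff_of_par {i : ι} {e c : ι × ℤ} (h : Par P i e) : Par P i c ↔ Par P e.1 c := by
  obtain ⟨s, hs⟩ := h.exists_smul_eq
  obtain ⟨t, ht⟩ := h
  constructor
  · rintro ⟨r, hr⟩; exact ⟨r * s, by rw [hr, hs, smul_smul]⟩
  · rintro ⟨r, hr⟩; exact ⟨r * t, by rw [hr, ht, smul_smul]⟩

lemma Par.exists_affEval_eq {e c : ι × ℤ} (h : Par P e.1 c) :
    ∃ r t : ℝ, r ≠ 0 ∧ ∀ x, affEval P c x = r * affEval P e x + t := by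
  obtain ⟨r, hr⟩ := h
  refine ⟨r, c.2 - r * e.2, ?_, fun x => ?_⟩
  · rintro rfl; exact P.ne_zero c.1 (by simpa using hr)
  · simp only [affEval, RootPairing.root', hr, map_smul, LinearMap.smul_apply, smul_eq_mul]
    ring

lemma par_actRoot_weylRefl_iff [P.IsCrystallographic] {e : affineRoots P} {c : ι × ℤ} :
    Par P (e : ι × ℤ).1 (actRoot P (weylRefl P e) c) ↔ Par P (e : ι × ℤ).1 c := by
  have h : ∀ c, Par P (e : ι × ℤ).1 c → Par P (e : ι × ℤ).1 (actRoot P (weylRefl P e) c) := by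
    rintro c ⟨r, hr⟩
    refine ⟨-r, ?_⟩
    rw [← linAct_root, linAct_weylRefl, hr, map_smul, P.reflection_apply_self, smul_neg, neg_smul]
  refine ⟨fun h' => ?_, h c⟩
  have := h _ h'
  rwa [← actRoot_mul, weylRefl_mul_self, actRoot_one] at this

end Par

/-! ### Inversions and the exchange property -/

namespace SimpleSystem

variable {P : RootPairing ι ℝ M N} (b : SimpleSystem P) {θ : ι}

lemma simpleRefl_eq (a : b.affSimple θ) :
    b.simpleRefl θ a = weylRefl P ⟨a, b.affSimple_subset θ a.2⟩ := rfl

lemma simpleRefl_mul_self (a : b.affSimple θ) : b.simpleRefl θ a * b.simpleRefl θ a = 1 :=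
  weylRefl_mul_self P ⟨a, b.affSimple_subset θ a.2⟩

lemma simpleRefl_inv (a : b.affSimple θ) : (b.simpleRefl θ a)⁻¹ = b.simpleRefl θ a :=
  weylRefl_inv P ⟨a, b.affSimple_subset θ a.2⟩

lemma simpleRefl_mul_mul (a : b.affSimple θ) (z : affineWeyl P) :
    b.simpleRefl θ a * (b.simpleRefl θ a * z) = z := by
  rw [← mul_assoc, simpleRefl_mul_self, one_mul]

lemma isReducedWord_tail {a : b.affSimple θ} {L : List (b.affSimple θ)} {w : affineWeyl P}
    (h : b.IsReducedWord θ (a :: L) w) :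
    b.IsReducedWord θ L (L.map (b.simpleRefl θ)).prod := by
  refine ⟨rfl, fun L' hL' => ?_⟩
  have := h.2 (a :: L') (by rw [← h.1]; simp [hL'])
  simpa using this

variable [P.IsCrystallographic]

lemma actRoot_simpleRefl (a : b.affSimple θ) : actRoot P (b.simpleRefl θ a) a = negRoot P a :=
  actRoot_weylRefl_self P ⟨a, b.affSimple_subset θ a.2⟩

lemma simpleRefl_mul (a : b.affSimple θ) (z : affineWeyl P) (e : affineRoots P)
    (h : actRoot P z e = a) : b.simpleRefl θ a * z = z * weylRefl P e := by
  rw [← weylRefl_actRoot, simpleRefl_eq]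
  congr 3
  exact h.symm

/-- All roots with `ω_λ = -1` vanish at `λ`, so this makes such a positive root unique in its
direction. Evaluation inside the alcove shows that the ratio is positive. -/
lemma eq_of_par [Finite ι] (hθ : b.IsHighest θ) {e c : ι × ℤ} (he : e ∈ b.affPos θ)
    (hc : c ∈ b.affPos θ) (h : Par P e.1 c) {x : N} (hex : affEval P e x = 0)
    (hcx : affEval P c x = 0) : c = e := by
  obtain ⟨r, t, hr, hrt⟩ := h.exists_affEval_eq
  have ht : t = 0 := by have := hrt x; rw [hex, hcx] at this; linarith
  obtain ⟨y, hy⟩ := b.exists_alcove_point hθ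
  have h1 := b.affEval_pos_of_mem hy he
  have h2 := b.affEval_pos_of_mem hy hc
  rw [hrt, ht, add_zero] at h2
  exact eq_of_root_eq_smul he.1 hc.1 (pos_of_mul_pos_left h2 h1.le)
    fun z => by rw [hrt, ht, add_zero]

/-- `s_a` fixes a generic point `x` of the wall of `a`. If `s_a c` were negative, `c` would be
nonpositive at `x`, hence zero there, hence equal to `a`. -/
lemma actRoot_simpleRefl_mem [Finite ι] (hθ : b.IsHighest θ) (a : b.affSimple θ) {c : ι × ℤ}
    (hc : c ∈ b.affPos θ) (hca : c ≠ a) : actRoot P (b.simpleRefl θ a) c ∈ b.affPos θ := by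
  refine (b.mem_affPos_or hθ (actRoot_mem P _ hc.1)).resolve_right fun h => hca ?_
  obtain ⟨x, hx0, hx⟩ := b.wall_nonneg hθ a.2
  refine (hx c hc).2 (le_antisymm ?_ (hx c hc).1)
  have := (hx _ h).1
  rw [affEval_negRoot, affEval_actRoot', simpleRefl_inv, simpleRefl_eq, weylRefl_smul,
    affRefl_of_affEval_eq_zero P hx0] at this
  linarith

/-- The set of positive affine roots which `z` makes negative. -/
def inversions (θ : ι) (z : affineWeyl P) : Set (ι × ℤ) :=
  {c ∈ b.affPos θ | negRoot P (actRoot P z c) ∈ b.affPos θ}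

lemma inversions_one (hθ : b.IsHighest θ) : b.inversions θ (1 : affineWeyl P) = ∅ := by
  ext c
  simp only [inversions, Set.mem_ofPred_eq, actRoot_one, Set.mem_empty_iff_false, iff_false]
  exact fun h => b.negRoot_notMem_affPos hθ h.1 h.2

lemma notMem_inversions (hθ : b.IsHighest θ) (a : b.affSimple θ) (z : affineWeyl P) :
    actRoot P z⁻¹ a ∉ b.inversions θ z := by
  rintro ⟨-, h⟩
  rw [actRoot_actRoot_inv] at h
  exact b.negRoot_notMem_affPos hθ (b.affSimple_subset_affPos a.2) h

/-- `s_a` permutes the positive roots other than `a`, so only the root sent to `a` by `z` changes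
status. -/
lemma inversions_simpleRefl_mul [Finite ι] (hθ : b.IsHighest θ) (a : b.affSimple θ)
    {z : affineWeyl P} (h : actRoot P z⁻¹ a ∈ b.affPos θ) :
    b.inversions θ (b.simpleRefl θ a * z) = insert (actRoot P z⁻¹ a) (b.inversions θ z) := by
  ext c
  simp only [inversions, Set.mem_insert_iff, Set.mem_ofPred_eq, actRoot_mul]
  constructor
  · rintro ⟨hc, hc'⟩
    rw [or_iff_not_imp_left]
    intro hne
    refine ⟨hc, ?_⟩
    rw [← actRoot_negRoot] at hc'
    have hne' : actRoot P (b.simpleRefl θ a) (negRoot P (actRoot P z c)) ≠ a := by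
      intro h'
      rw [actRoot_eq_iff, simpleRefl_inv, actRoot_simpleRefl] at h'
      have := congrArg (negRoot P) h'
      rw [negRoot_negRoot, negRoot_negRoot, actRoot_eq_iff] at this
      exact hne this
    have := b.actRoot_simpleRefl_mem hθ a hc' hne'
    rwa [← actRoot_mul, simpleRefl_mul_self, actRoot_one] at this
  · rintro (rfl | ⟨hc, hc'⟩)
    · refine ⟨h, ?_⟩
      rw [actRoot_actRoot_inv, actRoot_simpleRefl, negRoot_negRoot]
      exact b.affSimple_subset_affPos a.2
    · refine ⟨hc, ?_⟩
      rw [← actRoot_negRoot]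
      refine b.actRoot_simpleRefl_mem hθ a hc' fun h' => ?_
      have : c = negRoot P (actRoot P z⁻¹ a) := by
        rw [← h', actRoot_negRoot, actRoot_inv_actRoot, negRoot_negRoot]
      exact b.negRoot_notMem_affPos hθ h (this ▸ hc)

lemma actRoot_inv_simpleRefl_mul (a : b.affSimple θ) (z : affineWeyl P) :
    actRoot P (b.simpleRefl θ a * z)⁻¹ a = negRoot P (actRoot P z⁻¹ a) := by
  rw [mul_inv_rev, simpleRefl_inv, actRoot_mul, actRoot_simpleRefl, actRoot_negRoot]

/-- Finiteness makes the `finsum` in `invSum` a genuine sum instead of the default value 0. -/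
lemma inversions_finite [Finite ι] (hθ : b.IsHighest θ) (L : List (b.affSimple θ)) :
    (b.inversions θ (L.map (b.simpleRefl θ)).prod).Finite := by
  induction L with
  | nil => simp [inversions_one b hθ]
  | cons a L ih =>
    rw [List.map_cons, List.prod_cons]
    set z := (L.map (b.simpleRefl θ)).prod
    rcases b.mem_affPos_or hθ (actRoot_mem P z⁻¹ (b.affSimple_subset θ a.2)) with h | h
    · rw [b.inversions_simpleRefl_mul hθ a h]
      exact ih.insert _
    · rw [← actRoot_inv_simpleRefl_mul] at h
      have := b.inversions_simpleRefl_mul hθ a h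
      rw [simpleRefl_mul_mul] at this
      exact ih.subset (this ▸ Set.subset_insert _ _)

/-- The strong exchange property. -/
lemma exists_shorter_word [Finite ι] (hθ : b.IsHighest θ) (e : affineRoots P)
    (he : (e : ι × ℤ) ∈ b.affPos θ) (L : List (b.affSimple θ))
    (h : negRoot P (actRoot P (L.map (b.simpleRefl θ)).prod e) ∈ b.affPos θ) :
    ∃ L' : List (b.affSimple θ), L'.length < L.length ∧
      (L'.map (b.simpleRefl θ)).prod = (L.map (b.simpleRefl θ)).prod * weylRefl P e := by
  induction L with
  | nil =>
    rw [List.map_nil, List.prod_nil, actRoot_one] at h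
    exact absurd h (b.negRoot_notMem_affPos hθ he)
  | cons a L ih =>
    rw [List.map_cons, List.prod_cons] at h ⊢
    set z := (L.map (b.simpleRefl θ)).prod
    rcases b.mem_affPos_or hθ (actRoot_mem P z e.2) with h' | h'
    · have hza : actRoot P z e = a := by
        by_contra hne
        rw [actRoot_mul] at h
        exact b.negRoot_notMem_affPos hθ (b.actRoot_simpleRefl_mem hθ a h' hne) h
      refine ⟨L, by simp, ?_⟩
      rw [b.simpleRefl_mul a z e hza, mul_assoc, weylRefl_mul_self, mul_one]
    · obtain ⟨L', hL', h2⟩ := ih h'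
      exact ⟨a :: L', by simpa using hL', by rw [List.map_cons, List.prod_cons, h2, mul_assoc]⟩

/-- If `z⁻¹ a` were negative, the exchange property for its opposite would give a word of `s_a z`
shorter than `L`. -/
lemma actRoot_inv_mem_of_isReducedWord [Finite ι] (hθ : b.IsHighest θ) {a : b.affSimple θ}
    {L : List (b.affSimple θ)} {w : affineWeyl P} (h : b.IsReducedWord θ (a :: L) w) :
    actRoot P (L.map (b.simpleRefl θ)).prod⁻¹ a ∈ b.affPos θ := by
  obtain ⟨hw, hmin⟩ := h
  set z := (L.map (b.simpleRefl θ)).prod with hz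
  have hmem := actRoot_mem P z⁻¹ (b.affSimple_subset θ a.2)
  refine (b.mem_affPos_or hθ hmem).resolve_right fun hneg => ?_
  obtain ⟨L', hL', h2⟩ := b.exists_shorter_word hθ ⟨_, negRoot_mem P hmem⟩ hneg L (by
    rw [← hz, actRoot_negRoot, actRoot_actRoot_inv, negRoot_negRoot]
    exact b.affSimple_subset_affPos a.2)
  have h3 : weylRefl P ⟨_, negRoot_mem P hmem⟩ = weylRefl P ⟨_, hmem⟩ :=
    Subtype.ext (affRefl_negRoot P _)
  rw [← hz, h3, ← b.simpleRefl_mul a z ⟨_, hmem⟩ (actRoot_actRoot_inv P z a)] at h2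
  have := hmin L' (by rw [h2, ← hw, List.map_cons, List.prod_cons])
  rw [List.length_cons] at this
  omega

/-! ### Sums of orders over parallel inversions -/

section Valuation

variable (θ) (v : ι × ℤ → ℤ) (i : ι)

/-- The sum of the values of `v` at the inversions of `z` which are parallel to the root `i`. -/
def invSum (z : affineWeyl P) : ℤ := ∑ᶠ c ∈ b.inversions θ z ∩ {c | Par P i c}, v c

lemma invSum_one (hθ : b.IsHighest θ) : b.invSum θ v i (1 : affineWeyl P) = 0 := by
  simp [invSum, b.inversions_one hθ]

variable {θ}

lemma invSum_of_par [Finite ι] (hθ : b.IsHighest θ) (a : b.affSimple θ)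
    {L : List (b.affSimple θ)} {z : affineWeyl P} (hL : (L.map (b.simpleRefl θ)).prod = z)
    (h : actRoot P z⁻¹ a ∈ b.affPos θ) (hi : Par P i (actRoot P z⁻¹ a)) :
    b.invSum θ v i (b.simpleRefl θ a * z) = b.invSum θ v i z + v (actRoot P z⁻¹ a) := by
  rw [invSum, b.inversions_simpleRefl_mul hθ a h, Set.insert_inter_of_mem (t := {c | Par P i c}) hi,
    finsum_mem_insert _ (fun h => b.notMem_inversions hθ a z h.1)
      ((hL ▸ b.inversions_finite hθ L).inter_of_left _), add_comm]
  rfl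

lemma invSum_of_not_par [Finite ι] (hθ : b.IsHighest θ) (a : b.affSimple θ)
    {z : affineWeyl P} (hi : ¬ Par P i (actRoot P z⁻¹ a)) :
    b.invSum θ v i (b.simpleRefl θ a * z) = b.invSum θ v i z := by
  have key : ∀ z : affineWeyl P, actRoot P z⁻¹ a ∈ b.affPos θ → ¬ Par P i (actRoot P z⁻¹ a) →
      b.invSum θ v i (b.simpleRefl θ a * z) = b.invSum θ v i z := fun z h hi => by
    rw [invSum, b.inversions_simpleRefl_mul hθ a h, Set.insert_inter_of_notMem (t := {c | Par P i c}) hi]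
    rfl
  rcases b.mem_affPos_or hθ (actRoot_mem P z⁻¹ (b.affSimple_subset θ a.2)) with h | h
  · exact key z h hi
  -- When `z⁻¹ a` is negative, `z` and `s_a z` exchange their roles.
  · rw [← actRoot_inv_simpleRefl_mul] at h
    have := key _ h (by rwa [actRoot_inv_simpleRefl_mul, par_negRoot_iff])
    rw [simpleRefl_mul_mul] at this
    exact this.symm

lemma invSum_congr {j : ι × ℤ} (h : Par P i j) (z : affineWeyl P) :
    b.invSum θ v i z = b.invSum θ v j.1 z := by
  have : {c | Par P i c} = {c | Par P j.1 c} := Set.ext fun c => h.iff_of_par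
  rw [invSum, this, invSum]

variable (θ) in
/-- The sum of the values of `v` at the positive affine roots which are parallel to `e` and
which separate the fundamental alcove from the wall of `e`. -/
def wallSum (e : ι × ℤ) : ℤ :=
  ∑ᶠ c ∈ {c ∈ b.affPos θ | ∃ r t : ℝ, 0 < r ∧ t < 0 ∧ ∀ x, affEval P c x = r * affEval P e x + t},
    v c

/-- The alcove moved by `z⁻¹` touches the wall of `e`. At a generic point of that face `e` vanishes
and `c = r e + t` takes the value `t`, whose sign decides whether `z` inverts `c`. The sum is
therefore the same for all such `z`, which is what normalises the sign in `WallCondition`. -/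
lemma invSum_eq_wallSum [Finite ι] (hθ : b.IsHighest θ) (a : b.affSimple θ) {z : affineWeyl P}
    {e : ι × ℤ} (he : e ∈ b.affPos θ) (hz : actRoot P z⁻¹ a = e) :
    b.invSum θ v e.1 z = b.wallSum θ v e := by
  rw [invSum, wallSum]
  suffices h : b.inversions θ z ∩ {c | Par P e.1 c} = {c ∈ b.affPos θ |
      ∃ r t : ℝ, 0 < r ∧ t < 0 ∧ ∀ x, affEval P c x = r * affEval P e x + t} by rw [h]
  ext c
  obtain ⟨x, hx0, hx⟩ := b.wall_nonneg hθ a.2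
  have hza : actRoot P z e = a := by rw [← hz, actRoot_actRoot_inv]
  have hzx : affEval P e (z⁻¹ • x) = 0 := by rw [← affEval_actRoot', hza, hx0]
  obtain ⟨y, hy⟩ := b.exists_alcove_point hθ
  constructor
  · rintro ⟨⟨hc, hc'⟩, hce⟩
    obtain ⟨r, t, hr, hrt⟩ := Par.exists_affEval_eq hce
    have h1 := (hx _ hc').1
    rw [affEval_negRoot, affEval_actRoot', hrt, hzx] at h1
    have h2 := b.affEval_pos_of_mem hy he
    have h3 := b.affEval_pos_of_mem hy hc
    rw [hrt] at h3
    have hr : 0 < r := by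
      by_contra hr
      nlinarith
    refine ⟨hc, r, t, hr, lt_of_le_of_ne (by linarith) ?_, hrt⟩
    rintro rfl
    have : c = e := eq_of_root_eq_smul he.1 hc.1 hr fun x => by rw [hrt, add_zero]
    rw [this, hza] at hc'
    exact b.negRoot_notMem_affPos hθ (b.affSimple_subset_affPos a.2) hc'
  · rintro ⟨hc, r, t, hr, ht, hrt⟩
    refine ⟨⟨hc, (b.mem_affPos_or hθ (actRoot_mem P z hc.1)).resolve_left fun h => ?_⟩, r, ?_⟩
    · have := (hx _ h).1
      rw [affEval_actRoot', hrt, hzx] at this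
      linarith
    · refine root_eq_of_root'_eq_smul P fun x => ?_
      have h0 := hrt 0
      have hx := hrt x
      simp only [affEval, map_zero] at h0 hx
      linarith

end Valuation

end SimpleSystem

end QDHA

namespace QDHA

variable {ι M N : Type*} [AddCommGroup M] [Module ℝ M] [AddCommGroup N] [Module ℝ N]

/-- The field of rational functions on `V`. -/
abbrev RatFun (M : Type*) [AddCommGroup M] [Module ℝ M] : Type _ := FractionRing (PolyFun M)

/-! ### The action of `W_S` on polynomials and rational functions -/

section Action

variable (P : RootPairing ι ℝ M N)

/-- Evaluation of complex polynomial functions at a point of `V`. -/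
def evalAt (x : N) : PolyFun M →ₐ[ℂ] ℂ :=
  SymmetricAlgebra.lift (TensorProduct.AlgebraTensorModule.lift
    (LinearMap.toSpanSingleton ℂ (M →ₗ[ℝ] ℂ)
      (Complex.ofRealCLM.toLinearMap ∘ₗ P.toLinearMap.flip x)))

lemma evalAt_ι (x : N) (m : M) :
    evalAt P x (SymmetricAlgebra.ι ℂ (ℂ ⊗[ℝ] M) (1 ⊗ₜ m)) = P.toLinearMap m x := by
  rw [evalAt, SymmetricAlgebra.lift_ι_apply]
  simp

/-- The action of `z ∈ W_S` on `ℂ[V]`, through its linear part. -/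
def polyAct (z : affineWeyl P) : PolyFun M →ₐ[ℂ] PolyFun M :=
  SymmetricAlgebra.lift (SymmetricAlgebra.ι ℂ (ℂ ⊗[ℝ] M) ∘ₗ
    (linAct P z : M →ₗ[ℝ] M).baseChange ℂ)

lemma polyAct_ι (z : affineWeyl P) (c : ℂ) (m : M) :
    polyAct P z (SymmetricAlgebra.ι ℂ (ℂ ⊗[ℝ] M) (c ⊗ₜ m)) =
      SymmetricAlgebra.ι ℂ (ℂ ⊗[ℝ] M) (c ⊗ₜ linAct P z m) := by
  rw [polyAct, SymmetricAlgebra.lift_ι_apply]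
  simp

lemma polyFun_algHom_ext {F G : PolyFun M →ₐ[ℂ] PolyFun M}
    (h : ∀ (c : ℂ) (m : M), F (SymmetricAlgebra.ι ℂ (ℂ ⊗[ℝ] M) (c ⊗ₜ m)) =
      G (SymmetricAlgebra.ι ℂ (ℂ ⊗[ℝ] M) (c ⊗ₜ m))) : F = G := by
  apply SymmetricAlgebra.algHom_ext
  refine LinearMap.ext fun x => ?_
  induction x using TensorProduct.induction_on with
  | zero => simp
  | tmul c m => exact h c m
  | add x y hx hy => rw [map_add, map_add, hx, hy]

lemma polyAct_one : polyAct P 1 = AlgHom.id ℂ (PolyFun M) :=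
  polyFun_algHom_ext fun c m => by rw [polyAct_ι, linAct_one]; rfl

lemma polyAct_mul (z w : affineWeyl P) : polyAct P (z * w) = (polyAct P z).comp (polyAct P w) :=
  polyFun_algHom_ext fun c m => by
    rw [AlgHom.comp_apply, polyAct_ι, polyAct_ι, polyAct_ι, linAct_mul]

lemma polyAct_weylRefl (e : affineRoots P) :
    polyAct P (weylRefl P e) = reflPoly P (e : ι × ℤ).1 :=
  polyFun_algHom_ext fun c m => by
    rw [polyAct_ι, linAct_weylRefl, reflPoly, SymmetricAlgebra.lift_ι_apply]
    simp

lemma polyAct_inv_apply (z : affineWeyl P) (f : PolyFun M) : polyAct P z⁻¹ (polyAct P z f) = f := by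
  rw [← AlgHom.comp_apply, ← polyAct_mul, inv_mul_cancel, polyAct_one, AlgHom.id_apply]

lemma polyAct_apply_inv (z : affineWeyl P) (f : PolyFun M) : polyAct P z (polyAct P z⁻¹ f) = f := by
  rw [← AlgHom.comp_apply, ← polyAct_mul, mul_inv_cancel, polyAct_one, AlgHom.id_apply]

lemma polyAct_injective (z : affineWeyl P) : Function.Injective (polyAct P z) :=
  Function.LeftInverse.injective (polyAct_inv_apply P z)

lemma polyAct_rootPoly [P.IsCrystallographic] (z : affineWeyl P) (e : ι × ℤ) :
    polyAct P z (rootPoly P e.1) = rootPoly P (actRoot P z e).1 := by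
  rw [rootPoly, polyAct_ι, linAct_root, rootPoly]

variable {P} in
lemma eq_of_polyAct_eq {z w : affineWeyl P} {lam : N} (h : ∀ f, polyAct P z f = polyAct P w f)
    (hl : z • lam = w • lam) : z = w := by
  refine eq_of_linAct_eq (fun m => P.toPerfPair.injective (LinearMap.ext fun x => ?_)) hl
  have := congrArg (evalAt P x) (h (SymmetricAlgebra.ι ℂ (ℂ ⊗[ℝ] M) (1 ⊗ₜ m)))
  rw [polyAct_ι, polyAct_ι, evalAt_ι, evalAt_ι] at this
  exact_mod_cast this

/-- The action of `z ∈ W_S` on the rational functions on `V`, through its linear part. -/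
def fracAct (z : affineWeyl P) : RatFun M →+* RatFun M :=
  IsFractionRing.map (A := PolyFun M) (B := PolyFun M) (j := (polyAct P z : PolyFun M →+* PolyFun M))
    (polyAct_injective P z)

@[simp] lemma fracAct_algebraMap (z : affineWeyl P) (f : PolyFun M) :
    fracAct P z (algebraMap (PolyFun M) (RatFun M) f) =
      algebraMap (PolyFun M) (RatFun M) (polyAct P z f) := by
  simp [fracAct, IsFractionRing.map]

lemma ratFun_ringHom_ext {F G : RatFun M →+* RatFun M}
    (h : ∀ f, F (algebraMap (PolyFun M) (RatFun M) f) = G (algebraMap (PolyFun M) (RatFun M) f)) :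
    F = G :=
  IsLocalization.ringHom_ext (nonZeroDivisors (PolyFun M)) (RingHom.ext h)

lemma fracAct_one (x : RatFun M) : fracAct P 1 x = x :=
  RingHom.congr_fun (ratFun_ringHom_ext (F := fracAct P 1) (G := RingHom.id _) fun f => by
    rw [fracAct_algebraMap, polyAct_one]; rfl) x

lemma fracAct_mul (z w : affineWeyl P) (x : RatFun M) :
    fracAct P (z * w) x = fracAct P z (fracAct P w x) :=
  RingHom.congr_fun (ratFun_ringHom_ext (F := fracAct P (z * w))
    (G := (fracAct P z).comp (fracAct P w)) fun f => by
      rw [RingHom.comp_apply]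
      simp only [fracAct_algebraMap]
      rw [polyAct_mul, AlgHom.comp_apply]) x

end Action

/-! ### Roots as primes, and orders along root hyperplanes -/

section Primes

variable (P : RootPairing ι ℝ M N)

/-- Once the root is completed to a basis, it is a variable of a polynomial ring. -/
lemma prime_rootPoly (i : ι) : Prime (rootPoly P i) := by
  have hne : (1 : ℂ) ⊗ₜ[ℝ] P.root i ≠ 0 := by
    intro h
    apply rootPoly_ne_zero P i
    rw [rootPoly, h, map_zero]
  have hli : LinearIndepOn ℂ id ({(1 : ℂ) ⊗ₜ[ℝ] P.root i} : Set (ℂ ⊗[ℝ] M)) :=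
    LinearIndepOn.singleton hne
  let B := Module.Basis.extend hli
  let k : hli.extend (Set.subset_univ _) := ⟨_, hli.subset_extend _ rfl⟩
  have hk : B k = (1 : ℂ) ⊗ₜ[ℝ] P.root i := Module.Basis.extend_apply_self hli k
  rw [← MulEquiv.prime_iff (SymmetricAlgebra.equivMvPolynomial B)]
  have : (SymmetricAlgebra.equivMvPolynomial B) (rootPoly P i) = MvPolynomial.X k := by
    have := SymmetricAlgebra.equivMvPolynomial_ι_apply B k
    rwa [hk] at this
  exact this ▸ MvPolynomial.X_prime

variable {P}

lemma Par.rootPoly_eq {i : ι} {c : ι × ℤ} (h : Par P i c) :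
    ∃ r : ℂ, r ≠ 0 ∧ rootPoly P c.1 = r • rootPoly P i := by
  obtain ⟨r, hr⟩ := h
  have hr0 : r ≠ 0 := by rintro rfl; exact P.ne_zero c.1 (by simpa using hr)
  refine ⟨r, by exact_mod_cast hr0, ?_⟩
  rw [rootPoly, hr, rootPoly, ← (SymmetricAlgebra.ι ℂ (ℂ ⊗[ℝ] M)).map_smul,
    TensorProduct.tmul_smul, TensorProduct.smul_tmul', TensorProduct.smul_tmul']
  congr 2

/-- Evaluate at a point where the root `i` vanishes and the other root does not. -/
lemma not_rootPoly_dvd {i : ι} {c : ι × ℤ} (h : ¬ Par P i c) :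
    ¬ rootPoly P i ∣ rootPoly P c.1 := by
  intro hd
  have hspan : P.root c.1 ∉ Submodule.span ℝ {P.root i} := by
    rw [Submodule.mem_span_singleton]
    rintro ⟨r, hr⟩
    exact h ⟨r, hr.symm⟩
  obtain ⟨f, hf, hfi⟩ := Submodule.exists_dual_map_eq_bot_of_notMem hspan inferInstance
  have hi : f (P.root i) = 0 := by
    have : f (P.root i) ∈ (Submodule.span ℝ {P.root i}).map f :=
      Submodule.mem_map_of_mem (Submodule.mem_span_singleton_self _)
    rw [hfi] at this
    simpa using this
  have hd' := map_dvd (evalAt P (P.toLinearMap.flip.toPerfPair.symm f)) hd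
  rw [rootPoly, rootPoly, evalAt_ι, evalAt_ι, LinearMap.apply_toPerfPair_flip,
    LinearMap.apply_toPerfPair_flip, hi] at hd'
  simp at hd'
  exact hf hd'

lemma rootPoly_negRoot (c : ι × ℤ) : rootPoly P (negRoot P c).1 = -rootPoly P c.1 := by
  rw [rootPoly, root_negRoot, TensorProduct.tmul_neg, map_neg, rootPoly]

variable (P)

/-- The root `α = P.root i`, as a rational function. -/
def rootRat (i : ι) : RatFun M := algebraMap (PolyFun M) (RatFun M) (rootPoly P i)

lemma rootRat_ne_zero (i : ι) : rootRat P i ≠ 0 := by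
  rw [rootRat, Ne, FaithfulSMul.algebraMap_eq_zero_iff]
  exact rootPoly_ne_zero P i

lemma fracAct_rootRat [P.IsCrystallographic] (z : affineWeyl P) (e : ι × ℤ) :
    fracAct P z (rootRat P e.1) = rootRat P (actRoot P z e).1 := by
  rw [rootRat, fracAct_algebraMap, polyAct_rootPoly, rootRat]

@[simp] lemma rootRat_negRoot (c : ι × ℤ) : rootRat P (negRoot P c).1 = -rootRat P c.1 := by
  rw [rootRat, rootPoly_negRoot, map_neg, rootRat]

/-- The rational functions whose order of vanishing along the hyperplane of the root `i` is at
least `n`. -/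
def locOrd (i : ι) (n : ℤ) : Submodule (PolyFun M) (RatFun M) where
  carrier := {x | ∃ f q : PolyFun M, ¬ rootPoly P i ∣ q ∧
    x * algebraMap (PolyFun M) (RatFun M) q = rootRat P i ^ n * algebraMap (PolyFun M) (RatFun M) f}
  add_mem' := by
    rintro x y ⟨f, q, hq, h⟩ ⟨g, r, hr, h'⟩
    refine ⟨f * r + g * q, q * r, fun hd => ?_, ?_⟩
    · exact ((prime_rootPoly P i).dvd_or_dvd hd).elim hq hr
    · simp only [map_mul, map_add]
      linear_combination (algebraMap (PolyFun M) (RatFun M) r) * h +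
        (algebraMap (PolyFun M) (RatFun M) q) * h'
  zero_mem' := ⟨0, 1, (prime_rootPoly P i).not_dvd_one, by simp⟩
  smul_mem' := by
    rintro g x ⟨f, q, hq, h⟩
    refine ⟨g * f, q, hq, ?_⟩
    rw [Algebra.smul_def, map_mul]
    linear_combination (algebraMap (PolyFun M) (RatFun M) g) * h

variable {P}

lemma locOrd_mul {i : ι} {m n : ℤ} {x y : RatFun M} (hx : x ∈ locOrd P i m)
    (hy : y ∈ locOrd P i n) : x * y ∈ locOrd P i (m + n) := by
  obtain ⟨f, q, hq, h⟩ := hx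
  obtain ⟨g, r, hr, h'⟩ := hy
  refine ⟨f * g, q * r, fun hd => ((prime_rootPoly P i).dvd_or_dvd hd).elim hq hr, ?_⟩
  simp only [map_mul]
  rw [zpow_add₀ (rootRat_ne_zero P i)]
  linear_combination (y * algebraMap (PolyFun M) (RatFun M) r) * h +
    rootRat P i ^ m * algebraMap (PolyFun M) (RatFun M) f * h'

lemma algebraMap_mem_locOrd (i : ι) (f : PolyFun M) :
    algebraMap (PolyFun M) (RatFun M) f ∈ locOrd P i 0 :=
  ⟨f, 1, (prime_rootPoly P i).not_dvd_one, by simp⟩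

lemma one_mem_locOrd (i : ι) : (1 : RatFun M) ∈ locOrd P i 0 := by
  simpa using algebraMap_mem_locOrd (P := P) i 1

lemma rootRat_zpow_mem_locOrd_self (i : ι) (n : ℤ) : rootRat P i ^ n ∈ locOrd P i n :=
  ⟨1, 1, (prime_rootPoly P i).not_dvd_one, by simp⟩

lemma locOrd_mono {i : ι} {m n : ℤ} (h : m ≤ n) : locOrd P i n ≤ locOrd P i m := by
  rintro x ⟨f, q, hq, hx⟩
  refine ⟨rootPoly P i ^ (n - m).toNat * f, q, hq, ?_⟩
  rw [hx, map_mul, map_pow, ← rootRat, ← zpow_natCast, Int.toNat_of_nonneg (by omega), ← mul_assoc,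
    ← zpow_add₀ (rootRat_ne_zero P i)]
  congr 2
  omega

lemma locOrd_mul_of_le {i : ι} {k m n : ℤ} {x y : RatFun M} (hx : x ∈ locOrd P i k)
    (hy : y ∈ locOrd P i m) (h : n ≤ k + m) : x * y ∈ locOrd P i n :=
  locOrd_mono h (locOrd_mul hx hy)

lemma algebraMap_mem_locOrd_one {i : ι} {f : PolyFun M} (h : rootPoly P i ∣ f) :
    algebraMap (PolyFun M) (RatFun M) f ∈ locOrd P i 1 := by
  obtain ⟨g, rfl⟩ := h
  rw [map_mul]
  have := locOrd_mul (rootRat_zpow_mem_locOrd_self (P := P) i 1) (algebraMap_mem_locOrd i g)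
  simpa [rootRat] using this

lemma Par.locOrd_le {i : ι} {c : ι × ℤ} (h : Par P i c) (n : ℤ) : locOrd P c.1 n ≤ locOrd P i n := by
  obtain ⟨r, hr, hrc⟩ := h.rootPoly_eq
  rintro x ⟨f, q, hq, hx⟩
  have hrat : rootRat P c.1 =
      algebraMap (PolyFun M) (RatFun M) (algebraMap ℂ (PolyFun M) r) * rootRat P i := by
    rw [rootRat, hrc, Algebra.smul_def, map_mul, rootRat]
  have hz : (algebraMap (PolyFun M) (RatFun M) (algebraMap ℂ (PolyFun M) r)) ^ n =
      algebraMap (PolyFun M) (RatFun M) (algebraMap ℂ (PolyFun M) (r ^ n)) := by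
    rw [← IsScalarTower.algebraMap_apply, ← IsScalarTower.algebraMap_apply, map_zpow₀]
  refine ⟨algebraMap ℂ (PolyFun M) (r ^ n) * f, q, fun hd => hq (Dvd.dvd.trans ?_ hd), ?_⟩
  · refine ⟨algebraMap ℂ (PolyFun M) r⁻¹, ?_⟩
    rw [hrc, Algebra.smul_def, mul_right_comm, ← map_mul, mul_inv_cancel₀ hr, map_one, one_mul]
  · rw [hx, hrat, mul_zpow, hz, map_mul]
    ring

lemma Par.locOrd_eq {i : ι} {c : ι × ℤ} (h : Par P i c) (n : ℤ) : locOrd P i n = locOrd P c.1 n := by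
  refine le_antisymm ?_ (h.locOrd_le n)
  obtain ⟨r, hr⟩ := h.exists_smul_eq
  -- `Par` takes an affine root on its second side; the constant 0 is immaterial.
  exact Par.locOrd_le (i := c.1) (c := (i, 0)) ⟨r, hr⟩ n

lemma Par.rootRat_zpow_mem {i : ι} {c : ι × ℤ} (h : Par P i c) (n : ℤ) :
    rootRat P c.1 ^ n ∈ locOrd P i n := by
  rw [h.locOrd_eq]
  exact rootRat_zpow_mem_locOrd_self c.1 n

lemma rootRat_zpow_mem_of_not_par {i : ι} {c : ι × ℤ} (h : ¬ Par P i c) (n : ℤ) :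
    rootRat P c.1 ^ n ∈ locOrd P i 0 := by
  have hpow : ∀ m : ℕ, ¬ rootPoly P i ∣ rootPoly P c.1 ^ m := fun m hd =>
    not_rootPoly_dvd h ((prime_rootPoly P i).dvd_of_dvd_pow hd)
  obtain ⟨m, rfl | rfl⟩ := n.eq_nat_or_neg
  · rw [zpow_natCast, rootRat, ← map_pow]
    exact algebraMap_mem_locOrd i _
  · refine ⟨1, rootPoly P c.1 ^ m, hpow m, ?_⟩
    rw [map_pow, ← rootRat, zpow_neg, zpow_natCast, inv_mul_cancel₀ (pow_ne_zero _
      (rootRat_ne_zero P c.1))]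
    simp

/-- Nonnegative powers of congruent elements are congruent; for `-1`, the difference of inverses is
`(d - c)/(cd)` with `cd` a unit along the hyperplane. Order functions take no other exponents. -/
lemma zpow_sub_zpow_mem {i : ι} {c d : ι × ℤ} (hc : ¬ Par P i c) (hd : ¬ Par P i d)
    (h : rootPoly P i ∣ rootPoly P c.1 - rootPoly P d.1) {n : ℤ} (hn : -1 ≤ n) :
    rootRat P c.1 ^ n - rootRat P d.1 ^ n ∈ locOrd P i 1 := by
  rcases hn.eq_or_lt with rfl | hn
  · have e : rootRat P c.1 ^ (-1 : ℤ) - rootRat P d.1 ^ (-1 : ℤ) =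
        (rootRat P c.1 ^ (-1 : ℤ) * rootRat P d.1 ^ (-1 : ℤ)) *
          algebraMap (PolyFun M) (RatFun M) (-(rootPoly P c.1 - rootPoly P d.1)) := by
      have h1 := rootRat_ne_zero P c.1
      have h2 := rootRat_ne_zero P d.1
      rw [map_neg, map_sub, ← rootRat, ← rootRat]
      field_simp
      ring
    rw [e]
    exact locOrd_mul_of_le (locOrd_mul (rootRat_zpow_mem_of_not_par hc _)
      (rootRat_zpow_mem_of_not_par hd _)) (algebraMap_mem_locOrd_one (dvd_neg.2 h)) (by norm_num)
  · obtain ⟨m, rfl⟩ := Int.eq_ofNat_of_zero_le (by omega : 0 ≤ n)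
    rw [zpow_natCast, zpow_natCast, rootRat, rootRat, ← map_pow, ← map_pow, ← map_sub]
    exact algebraMap_mem_locOrd_one (h.trans (sub_dvd_pow_sub_pow _ _ m))

variable (P) in
/-- The rational functions with denominator a product of roots. -/
def rootDenom : Subring (RatFun M) where
  carrier := {x | ∃ d ∈ Submonoid.closure (Set.range (rootPoly P)), ∃ f : PolyFun M,
    x * algebraMap (PolyFun M) (RatFun M) d = algebraMap (PolyFun M) (RatFun M) f}
  mul_mem' := by
    rintro x y ⟨d, hd, f, hf⟩ ⟨d', hd', f', hf'⟩
    refine ⟨d * d', mul_mem hd hd', f * f', ?_⟩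
    rw [map_mul, map_mul, ← hf, ← hf']
    ring
  one_mem' := ⟨1, one_mem _, 1, by simp⟩
  add_mem' := by
    rintro x y ⟨d, hd, f, hf⟩ ⟨d', hd', f', hf'⟩
    refine ⟨d * d', mul_mem hd hd', f * d' + f' * d, ?_⟩
    simp only [map_mul, map_add]
    rw [← hf, ← hf']
    ring
  zero_mem' := ⟨1, one_mem _, 0, by simp⟩
  neg_mem' := by
    rintro x ⟨d, hd, f, hf⟩
    exact ⟨d, hd, -f, by rw [map_neg, ← hf, neg_mul]⟩

lemma algebraMap_mem_rootDenom (f : PolyFun M) :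
    algebraMap (PolyFun M) (RatFun M) f ∈ rootDenom P :=
  ⟨1, one_mem _, f, by simp⟩

lemma rootRat_zpow_mem_rootDenom (i : ι) (n : ℤ) : rootRat P i ^ n ∈ rootDenom P := by
  obtain ⟨m, rfl | rfl⟩ := n.eq_nat_or_neg
  · rw [zpow_natCast]
    exact pow_mem (algebraMap_mem_rootDenom _) m
  · refine ⟨rootPoly P i ^ m, pow_mem (Submonoid.subset_closure (Set.mem_range_self i)) m, 1, ?_⟩
    rw [map_pow, ← rootRat, zpow_neg, zpow_natCast, inv_mul_cancel₀ (pow_ne_zero _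
      (rootRat_ne_zero P i)), map_one]

/-- Roots are prime, so regularity along each hyperplane cancels the factors of the denominator one
at a time. -/
lemma exists_algebraMap_eq {x : RatFun M} (hx : x ∈ rootDenom P) (h : ∀ i, x ∈ locOrd P i 0) :
    ∃ f : PolyFun M, algebraMap (PolyFun M) (RatFun M) f = x := by
  obtain ⟨d, hd, f, hf⟩ := hx
  induction hd using Submonoid.closure_induction_left generalizing f with
  | one => exact ⟨f, by simpa using hf.symm⟩
  | mul_left p hp d hd ih =>
    obtain ⟨i, rfl⟩ := hp
    obtain ⟨g, q, hq, hg⟩ := h i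
    rw [zpow_zero, one_mul] at hg
    have h1 : f * q = rootPoly P i * (d * g) := by
      apply FaithfulSMul.algebraMap_injective (PolyFun M) (RatFun M)
      simp only [map_mul]
      rw [← hf, ← hg, map_mul]
      ring
    obtain ⟨f', rfl⟩ := ((prime_rootPoly P i).dvd_or_dvd (Dvd.intro _ h1.symm)).resolve_right hq
    refine ih f' (mul_left_cancel₀ (rootRat_ne_zero P i) ?_)
    rw [map_mul, map_mul, ← rootRat] at hf
    rw [← hf]
    ring

end Primes

end QDHA

namespace QDHA

variable {ι M N : Type*} [AddCommGroup M] [Module ℝ M] [AddCommGroup N] [Module ℝ N]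
variable {P : RootPairing ι ℝ M N}

lemma neg_one_zpow_mul_mem {i : ι} {m : ℤ} {x : RatFun M} (n : ℤ) (hx : x ∈ locOrd P i m) :
    (-1) ^ n * x ∈ locOrd P i m := by
  rcases Int.even_or_odd n with h | h
  · rwa [h.neg_one_zpow, one_mul]
  · rw [h.neg_one_zpow, neg_one_mul]
    exact neg_mem hx

lemma sub_ite_mem {A : Submodule (PolyFun M) (RatFun M)} {x y : RatFun M} {p : Prop} [Decidable p]
    (hx : x ∈ A) (hy : y ∈ A) : x - (if p then y else 0) ∈ A := by
  split_ifs
  · exact sub_mem hx hy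
  · exact sub_mem hx (zero_mem _)

lemma weylRefl_smul_orbit {lam0 : N} (e : affineRoots P) (lam : Orbit P lam0)
    (h : affEval P e (lam : N) = 0) : weylRefl P e • lam = lam := by
  apply Subtype.ext
  rw [MulAction.orbit.coe_smul, weylRefl_smul, affRefl_of_affEval_eq_zero P h]

/-! ### Order functions and their sums along words -/

namespace SimpleSystem

variable (b : SimpleSystem P) {θ : ι}
variable {lam0 : N} {ω : Orbit P lam0 → ι × ℤ → ℤ}

namespace IsOrderFamily

variable {b} (hω : b.IsOrderFamily θ lam0 ω)
include hω

lemma neg_one_le_simple (a : b.affSimple θ) (lam : Orbit P lam0) : -1 ≤ ω lam a :=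
  hω.neg_one_le lam a (b.affSimple_subset_affPos a.2)

lemma simpleRefl_smul (a : b.affSimple θ) {lam : Orbit P lam0} (h : ω lam a = -1) :
    b.simpleRefl θ a • lam = lam := by
  apply Subtype.ext
  rw [MulAction.orbit.coe_smul]
  exact affRefl_of_affEval_eq_zero P
    (hω.eval_eq_zero lam a (b.affSimple_subset_affPos a.2) h)

lemma simpleRefl_smul' (a : b.affSimple θ) {lam : Orbit P lam0}
    (h : ω (b.simpleRefl θ a • lam) a = -1) : b.simpleRefl θ a • lam = lam := by
  have := hω.simpleRefl_smul a h
  rw [← mul_smul, simpleRefl_mul_self, one_smul] at this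
  exact this.symm

lemma eq_neg_one_iff (a : b.affSimple θ) (lam : Orbit P lam0) :
    ω (b.simpleRefl θ a • lam) a = -1 ↔ ω lam a = -1 :=
  ⟨fun h => by rwa [hω.simpleRefl_smul' a h] at h, fun h => by rwa [hω.simpleRefl_smul a h]⟩

variable [P.IsCrystallographic]

lemma smul_simple (a : b.affSimple θ) (z : affineWeyl P) (lam : Orbit P lam0)
    (h : actRoot P z⁻¹ a ∈ b.affPos θ) : ω (z • lam) a = ω lam (actRoot P z⁻¹ a) :=
  hω.equivariant lam z _ h a (b.affSimple_subset_affPos a.2) fun x => by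
    rw [affEval_actRoot', inv_inv]

/-- If `z⁻¹ a` is negative, replace `z` by `s_a z`: the order `-1` forces `s_a` to fix `zλ`, so the
value is unchanged. -/
lemma exists_of_eq_neg_one (hθ : b.IsHighest θ) (a : b.affSimple θ) (z : affineWeyl P)
    (lam : Orbit P lam0) (h : ω (z • lam) a = -1) : ∃ e ∈ b.affPos θ, ω lam e = -1 ∧
      (e = actRoot P z⁻¹ a ∨ e = negRoot P (actRoot P z⁻¹ a)) := by
  rcases b.mem_affPos_or hθ (actRoot_mem P z⁻¹ (b.affSimple_subset θ a.2)) with h' | h'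
  · exact ⟨_, h', by rw [← hω.smul_simple a z lam h', h], Or.inl rfl⟩
  · rw [← actRoot_inv_simpleRefl_mul] at h'
    refine ⟨_, h', ?_, Or.inr (b.actRoot_inv_simpleRefl_mul a z)⟩
    rw [← hω.smul_simple a _ lam h', mul_smul, hω.simpleRefl_smul a h, h]

end IsOrderFamily

variable [P.IsCrystallographic]

section InvSum

variable [Finite ι] (hθ : b.IsHighest θ) (hω : b.IsOrderFamily θ lam0 ω)
  (hgen : ∀ z : affineWeyl P, ∃ L : List (b.affSimple θ), (L.map (b.simpleRefl θ)).prod = z)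
  (lam : Orbit P lam0) (a : b.affSimple θ) {i : ι} {z : affineWeyl P}

include hθ hω hgen

lemma invSum_simpleRefl_mul (h : actRoot P z⁻¹ a ∈ b.affPos θ) (hi : Par P i (actRoot P z⁻¹ a)) :
    b.invSum θ (ω lam) i (b.simpleRefl θ a * z) = b.invSum θ (ω lam) i z + ω (z • lam) a := by
  obtain ⟨L, hL⟩ := hgen z
  rw [b.invSum_of_par _ _ hθ a hL h hi, hω.smul_simple a z lam h]

lemma invSum_simpleRefl_mul' (h : negRoot P (actRoot P z⁻¹ a) ∈ b.affPos θ)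
    (hi : Par P i (actRoot P z⁻¹ a)) :
    b.invSum θ (ω lam) i z =
      b.invSum θ (ω lam) i (b.simpleRefl θ a * z) + ω ((b.simpleRefl θ a * z) • lam) a := by
  have := b.invSum_simpleRefl_mul hθ hω hgen lam a (z := b.simpleRefl θ a * z) (i := i)
    (by rwa [actRoot_inv_simpleRefl_mul])
    (by rwa [actRoot_inv_simpleRefl_mul, par_negRoot_iff])
  rwa [simpleRefl_mul_mul] at this

/-- There is equality if `z⁻¹ a` is negative. Otherwise the gap is the sum of the orders of `a` at
`zλ` and at `s_a zλ`, both nonnegative once `-1` is excluded. -/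
lemma invSum_le (hi : Par P i (actRoot P z⁻¹ a)) (h : ω (z • lam) a ≠ -1) :
    b.invSum θ (ω lam) i z ≤
      ω ((b.simpleRefl θ a * z) • lam) a + b.invSum θ (ω lam) i (b.simpleRefl θ a * z) := by
  have h1 := hω.neg_one_le_simple a (z • lam)
  have h2 := hω.neg_one_le_simple a ((b.simpleRefl θ a * z) • lam)
  have h3 : ω ((b.simpleRefl θ a * z) • lam) a ≠ -1 := by
    rwa [mul_smul, Ne, hω.eq_neg_one_iff]
  rcases b.mem_affPos_or hθ (actRoot_mem P z⁻¹ (b.affSimple_subset θ a.2)) with h' | h'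
  · rw [b.invSum_simpleRefl_mul hθ hω hgen lam a h' hi]
    omega
  · rw [b.invSum_simpleRefl_mul' hθ hω hgen lam a h' hi]
    omega

end InvSum

/-! ### Coefficients of operators and the local conditions on them -/

open Classical in
/-- The operator `τ_a` on operators with source the factor of index `λ`, in terms of their
coefficients. The finitely supported family `T` stands for the operator `∑ z ∘ T z`, where `z` runs
over `W_S`. -/
def tauCoeff (θ : ι) (ω : Orbit P lam0 → ι × ℤ → ℤ) (lam : Orbit P lam0) (a : b.affSimple θ) :
    (affineWeyl P →₀ RatFun M) →ₗ[RatFun M] (affineWeyl P →₀ RatFun M) :=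
  Finsupp.lsum (RatFun M) fun z =>
    -- Coefficients stand to the right of group elements, so a power of `∂a` is moved across `s_a
    -- z`, or across `z` in the second term, by the inverse.
    rootRat P (actRoot P (b.simpleRefl θ a * z)⁻¹ a).1 ^ ω (z • lam) a •
        Finsupp.lsingle (b.simpleRefl θ a * z) -
      if ω (z • lam) a = -1 then
        rootRat P (actRoot P z⁻¹ a).1 ^ (-1 : ℤ) • Finsupp.lsingle z else 0

lemma tauCoeff_single (lam : Orbit P lam0) (a : b.affSimple θ) (z : affineWeyl P) (g : RatFun M) :
    b.tauCoeff θ ω lam a (Finsupp.single z g) =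
      Finsupp.single (b.simpleRefl θ a * z)
        (rootRat P (actRoot P (b.simpleRefl θ a * z)⁻¹ a).1 ^ ω (z • lam) a * g) -
      if ω (z • lam) a = -1 then
        Finsupp.single z (rootRat P (actRoot P z⁻¹ a).1 ^ (-1 : ℤ) * g) else 0 := by
  rw [tauCoeff, Finsupp.lsum_single]
  split_ifs <;> simp

/-- The contributions from `s_a z` and from `z` can be given a common factor because `s_a` fixes
`zλ` whenever the second one is present. -/
lemma tauCoeff_apply (hω : b.IsOrderFamily θ lam0 ω) (lam : Orbit P lam0) (a : b.affSimple θ)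
    (T : affineWeyl P →₀ RatFun M) (z : affineWeyl P) :
    b.tauCoeff θ ω lam a T z =
      rootRat P (actRoot P z⁻¹ a).1 ^ ω ((b.simpleRefl θ a * z) • lam) a *
        (T (b.simpleRefl θ a * z) -
          if ω ((b.simpleRefl θ a * z) • lam) a = -1 then T z else 0) := by
  classical
  induction T using Finsupp.induction_linear with
  | zero => simp
  | add T T' h h' =>
    rw [map_add, Finsupp.add_apply, h, h', Finsupp.add_apply, Finsupp.add_apply]
    split_ifs <;> ring
  | single w g =>
    rw [tauCoeff_single, Finsupp.sub_apply, mul_sub]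
    congr 1
    · by_cases hw : b.simpleRefl θ a * w = z
      · subst hw
        rw [simpleRefl_mul_mul, Finsupp.single_eq_same, Finsupp.single_eq_same]
      · rw [Finsupp.single_eq_of_ne (Ne.symm hw), Finsupp.single_eq_of_ne, mul_zero]
        rintro rfl
        rw [simpleRefl_mul_mul] at hw
        exact hw rfl
    · by_cases hw : w = z
      · subst hw
        rw [mul_smul]
        by_cases h : ω (w • lam) a = -1
        · rw [hω.simpleRefl_smul a h, if_pos h, if_pos h, Finsupp.single_eq_same,
            Finsupp.single_eq_same, h]
        · rw [if_neg h, if_neg (by rwa [hω.eq_neg_one_iff])]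
          simp
      · split_ifs <;> simp [Finsupp.single_eq_of_ne (Ne.symm hw)]

/-- The condition on the coefficients of an operator `∑ z ∘ T z` with source the factor of
index `λ`, for the direction of a positive affine root `e` with `ω_λ(e) = -1`. -/
structure WallCondition (θ : ι) (v : ι × ℤ → ℤ) (T : affineWeyl P →₀ RatFun M)
    (e : affineRoots P) (y : affineWeyl P) : Prop where
  refl_mem : T (y * weylRefl P e) ∈
    locOrd P (e : ι × ℤ).1 (b.invSum θ v (e : ι × ℤ).1 (y * weylRefl P e))
  refl_mem' : T (y * weylRefl P e) ∈
    locOrd P (e : ι × ℤ).1 (b.invSum θ v (e : ι × ℤ).1 y - 1)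
  -- The sign is trivial where the alcove moved by `y⁻¹` touches the wall of `e`. Elsewhere it
  -- reflects that `s_e` negates parallel roots, a factor of order `k` contributing `(-1)^k`.
  sub_mem : T y - (-1) ^ (b.invSum θ v (e : ι × ℤ).1 y - b.wallSum θ v e) *
    T (y * weylRefl P e) ∈ locOrd P (e : ι × ℤ).1 (b.invSum θ v (e : ι × ℤ).1 y)

/-- The conditions on the coefficients of an operator `∑ z ∘ T z` with source the factor of
index `λ` which characterise the quiver double Hecke algebra. -/
structure IsAdmissible (θ : ι) (v : ι × ℤ → ℤ) (T : affineWeyl P →₀ RatFun M) : Prop where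
  denom : ∀ z, T z ∈ rootDenom P
  free : ∀ i, (∀ e ∈ b.affPos θ, v e = -1 → ¬ Par P i e) → ∀ z,
    T z ∈ locOrd P i (b.invSum θ v i z)
  wall : ∀ e : affineRoots P, (e : ι × ℤ) ∈ b.affPos θ → v e = -1 → ∀ y,
    actRoot P y e ∈ b.affPos θ → b.WallCondition θ v T e y

lemma WallCondition.mem {b : SimpleSystem P} {v : ι × ℤ → ℤ} {T : affineWeyl P →₀ RatFun M}
    {e : affineRoots P} {y : affineWeyl P} (h : b.WallCondition θ v T e y) :
    T y ∈ locOrd P (e : ι × ℤ).1 (b.invSum θ v (e : ι × ℤ).1 y - 1) := by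
  have h1 := locOrd_mono (show b.invSum θ v (e : ι × ℤ).1 y - 1 ≤ _ by omega) h.sub_mem
  have := add_mem h1 (neg_one_zpow_mul_mem
    (b.invSum θ v (e : ι × ℤ).1 y - b.wallSum θ v e) h.refl_mem')
  rwa [sub_add_cancel] at this

/-! ### Stability of the local conditions under `τ_a` -/

section TauAdmissible

variable [Finite ι] (hθ : b.IsHighest θ) (hω : b.IsOrderFamily θ lam0 ω)
  (hgen : ∀ z : affineWeyl P, ∃ L : List (b.affSimple θ), (L.map (b.simpleRefl θ)).prod = z)
  (lam : Orbit P lam0) (a : b.affSimple θ) {T : affineWeyl P →₀ RatFun M}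

variable {e : affineRoots P} {y : affineWeyl P}

include hθ hω

/-- The factors at `y` and `y s_e` are powers of roots exchanged by `s_e`, hence units along the
hyperplane that are congruent modulo `e`. Their difference supplies the one order that `refl_mem'`
lacks. -/
lemma tauCoeff_wall_not_par (he : (e : ι × ℤ) ∈ b.affPos θ) (hv : ω lam e = -1)
    (hT : b.WallCondition θ (ω lam) T e (b.simpleRefl θ a * y))
    (hT' : b.WallCondition θ (ω lam) T e y)
    (hp : ¬ Par P (e : ι × ℤ).1 (actRoot P y⁻¹ a)) :
    b.WallCondition θ (ω lam) (b.tauCoeff θ ω lam a T) e y := by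
  have hlam : weylRefl P e • lam = lam := weylRefl_smul_orbit e lam (hω.eval_eq_zero lam e he hv)
  have hk := hω.neg_one_le_simple a ((b.simpleRefl θ a * y) • lam)
  have hpw : ¬ Par P (e : ι × ℤ).1 (actRoot P (y * weylRefl P e)⁻¹ a) := by
    rwa [mul_inv_rev, weylRefl_inv, actRoot_mul, par_actRoot_weylRefl_iff]
  have hnu : b.invSum θ (ω lam) (e : ι × ℤ).1 (b.simpleRefl θ a * y) =
      b.invSum θ (ω lam) (e : ι × ℤ).1 y := b.invSum_of_not_par _ _ hθ a hp
  have hnuw : b.invSum θ (ω lam) (e : ι × ℤ).1 (b.simpleRefl θ a * y * weylRefl P e) =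
      b.invSum θ (ω lam) (e : ι × ℤ).1 (y * weylRefl P e) := by
    rw [mul_assoc]
    exact b.invSum_of_not_par _ _ hθ a hpw
  have hTw : b.tauCoeff θ ω lam a T (y * weylRefl P e) =
      rootRat P (actRoot P (y * weylRefl P e)⁻¹ a).1 ^ ω ((b.simpleRefl θ a * y) • lam) a *
        (T (b.simpleRefl θ a * y * weylRefl P e) -
          if ω ((b.simpleRefl θ a * y) • lam) a = -1 then T (y * weylRefl P e) else 0) := by
    rw [b.tauCoeff_apply hω, ← mul_assoc, mul_smul _ (weylRefl P e), hlam]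
  obtain ⟨h1, h2, h3⟩ := hT
  rw [hnuw] at h1
  rw [hnu] at h2 h3
  have hmem := sub_ite_mem (p := ω ((b.simpleRefl θ a * y) • lam) a = -1) h2 hT'.refl_mem'
  constructor
  · rw [hTw]
    exact locOrd_mul_of_le (rootRat_zpow_mem_of_not_par hpw _) (sub_ite_mem h1 hT'.refl_mem)
      (zero_add _).ge
  · rw [hTw]
    exact locOrd_mul_of_le (rootRat_zpow_mem_of_not_par hpw _) hmem (zero_add _).ge
  · have hdvd : rootPoly P (e : ι × ℤ).1 ∣ rootPoly P (actRoot P y⁻¹ a).1 -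
        rootPoly P (actRoot P (y * weylRefl P e)⁻¹ a).1 := by
      rw [mul_inv_rev, weylRefl_inv, actRoot_mul, ← polyAct_rootPoly P (weylRefl P e), polyAct_weylRefl, dvd_sub_comm]
      exact rootPoly_dvd P _ _
    have hz := zpow_sub_zpow_mem hp hpw hdvd hk
    rw [hTw, b.tauCoeff_apply hω]
    set k := ω ((b.simpleRefl θ a * y) • lam) a
    set s := ((-1 : RatFun M)) ^ (b.invSum θ (ω lam) (e : ι × ℤ).1 y - b.wallSum θ (ω lam) e)
    have hs : ∀ x : RatFun M, x ∈ locOrd P (e : ι × ℤ).1 (b.invSum θ (ω lam) (e : ι × ℤ).1 y - 1) →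
      s * x ∈ locOrd P (e : ι × ℤ).1 (b.invSum θ (ω lam) (e : ι × ℤ).1 y - 1) :=
      fun x hx => neg_one_zpow_mul_mem _ hx
    have h4 := locOrd_mul_of_le (rootRat_zpow_mem_of_not_par hp k)
      (sub_ite_mem (p := k = -1) h3 hT'.sub_mem) (zero_add _).ge
    have h5 := locOrd_mul_of_le (n := b.invSum θ (ω lam) (e : ι × ℤ).1 y) hz (hs _ hmem)
      (by omega)
    convert add_mem h4 h5 using 1
    split_ifs <;> ring

include hgen

/-- A letter parallel to `i` has order at least 0 here, so it only contributes a power, bounded by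
`invSum_le`. Any other letter contributes a unit along the hyperplane and leaves `invSum` unchanged.
-/
lemma tauCoeff_free (hT : b.IsAdmissible θ (ω lam) T) (i : ι)
    (hi : ∀ e ∈ b.affPos θ, ω lam e = -1 → ¬ Par P i e) (z : affineWeyl P) :
    b.tauCoeff θ ω lam a T z ∈ locOrd P i (b.invSum θ (ω lam) i z) := by
  rw [b.tauCoeff_apply hω]
  by_cases hp : Par P i (actRoot P z⁻¹ a)
  · have h : ω (z • lam) a ≠ -1 := by
      intro h
      obtain ⟨e, he, he', rfl | rfl⟩ := hω.exists_of_eq_neg_one hθ a z lam h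
      · exact hi _ he he' hp
      · exact hi _ he he' hp.negRoot
    rw [if_neg (by rwa [mul_smul, hω.eq_neg_one_iff]), sub_zero]
    exact locOrd_mul_of_le (hp.rootRat_zpow_mem _) (hT.free i hi _)
      (b.invSum_le hθ hω hgen lam a hp h)
  · have := hT.free i hi (b.simpleRefl θ a * z)
    rw [b.invSum_of_not_par _ _ hθ a hp] at this
    exact locOrd_mul_of_le (rootRat_zpow_mem_of_not_par hp _)
      (sub_ite_mem this (hT.free i hi z)) (zero_add _).ge

/-- Here `s_a y = y s_e`, and the new coefficients at `y` and `y s_e` are the same divided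
difference `(T (y s_e) - T y) / e`. The sign is trivial at this wall, so the old congruence controls
the quotient and the new one reads `0`. -/
lemma tauCoeff_wall_self (he : (e : ι × ℤ) ∈ b.affPos θ) (hv : ω lam e = -1)
    (hT : b.WallCondition θ (ω lam) T e y) (hye : actRoot P y⁻¹ a = e) :
    b.WallCondition θ (ω lam) (b.tauCoeff θ ω lam a T) e y := by
  have hsy : b.simpleRefl θ a * y = y * weylRefl P e :=
    b.simpleRefl_mul a y e (by rw [← hye, actRoot_actRoot_inv])
  have hsw : b.simpleRefl θ a * (y * weylRefl P e) = y := by rw [← hsy, simpleRefl_mul_mul]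
  have hlam : weylRefl P e • lam = lam := weylRefl_smul_orbit e lam (hω.eval_eq_zero lam e he hv)
  have hpos : actRoot P y⁻¹ a ∈ b.affPos θ := hye ▸ he
  have hk : ω (y • lam) a = -1 := by rw [hω.smul_simple a y lam hpos, hye, hv]
  have hnu : b.invSum θ (ω lam) (e : ι × ℤ).1 (y * weylRefl P e) =
      b.invSum θ (ω lam) (e : ι × ℤ).1 y - 1 := by
    rw [← hsy, b.invSum_simpleRefl_mul hθ hω hgen lam a hpos (hye ▸ Par.refl _), hk]
    ring
  have hw : actRoot P (y * weylRefl P e)⁻¹ a = negRoot P e := by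
    rw [← hsy, actRoot_inv_simpleRefl_mul, hye]
  have hTw : b.tauCoeff θ ω lam a T (y * weylRefl P e) =
      -(rootRat P (e : ι × ℤ).1 ^ (-1 : ℤ) * (T y - T (y * weylRefl P e))) := by
    rw [b.tauCoeff_apply hω, hsw, hk, if_pos rfl, hw, rootRat_negRoot, zpow_neg_one, zpow_neg_one]
    ring
  have hTy : b.tauCoeff θ ω lam a T y = b.tauCoeff θ ω lam a T (y * weylRefl P e) := by
    rw [hTw, b.tauCoeff_apply hω, hsy, mul_smul, hlam, hk, if_pos rfl, hye]
    ring
  have hpar : b.invSum θ (ω lam) (e : ι × ℤ).1 y - b.wallSum θ (ω lam) e = 0 := by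
    rw [b.invSum_eq_wallSum _ hθ a he hye, sub_self]
  have hmem : b.tauCoeff θ ω lam a T (y * weylRefl P e) ∈
      locOrd P (e : ι × ℤ).1 (b.invSum θ (ω lam) (e : ι × ℤ).1 y - 1) := by
    rw [hTw]
    have := hT.sub_mem
    rw [hpar, zpow_zero, one_mul] at this
    exact neg_mem (locOrd_mul_of_le (rootRat_zpow_mem_locOrd_self _ _) this (by omega))
  refine ⟨hnu ▸ hmem, hmem, ?_⟩
  rw [hpar, hTy, zpow_zero, one_mul, sub_self]
  exact zero_mem _

/-- A parallel letter different from `e` has nonnegative order, by uniqueness of `e`. Both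
coefficients are multiplied by the same power up to the sign coming from `s_e` negating the root. -/
lemma tauCoeff_wall_par (he : (e : ι × ℤ) ∈ b.affPos θ) (hv : ω lam e = -1)
    (hye : actRoot P y e ∈ b.affPos θ)
    (hT : b.WallCondition θ (ω lam) T e (b.simpleRefl θ a * y)) (hne : actRoot P y⁻¹ a ≠ e)
    (hp : Par P (e : ι × ℤ).1 (actRoot P y⁻¹ a)) :
    b.WallCondition θ (ω lam) (b.tauCoeff θ ω lam a T) e y := by
  have hlam : weylRefl P e • lam = lam := weylRefl_smul_orbit e lam (hω.eval_eq_zero lam e he hv)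
  have hk : ω (y • lam) a ≠ -1 := by
    intro h
    obtain ⟨c, hc, hvc, hca⟩ := hω.exists_of_eq_neg_one hθ a y lam h
    have hce : c = e := by
      refine b.eq_of_par hθ he hc ?_ (hω.eval_eq_zero lam e he hv) (hω.eval_eq_zero lam c hc hvc)
      rcases hca with rfl | rfl
      · exact hp
      · exact hp.negRoot
    rcases hca with hca | hca
    · exact hne (hca ▸ hce)
    · rw [← hce, hca, actRoot_negRoot, actRoot_actRoot_inv] at hye
      exact b.negRoot_notMem_affPos hθ (b.affSimple_subset_affPos a.2) hye
  have hk' : ω ((b.simpleRefl θ a * y) • lam) a ≠ -1 := by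
    rwa [mul_smul, Ne, hω.eq_neg_one_iff]
  have hk1 := hω.neg_one_le_simple a (y • lam)
  have hk1' := hω.neg_one_le_simple a ((b.simpleRefl θ a * y) • lam)
  have hpw : Par P (e : ι × ℤ).1 (actRoot P (y * weylRefl P e)⁻¹ a) := by
    rwa [mul_inv_rev, weylRefl_inv, actRoot_mul, par_actRoot_weylRefl_iff]
  have hw : rootRat P (actRoot P (y * weylRefl P e)⁻¹ a).1 = -rootRat P (actRoot P y⁻¹ a).1 := by
    rw [mul_inv_rev, weylRefl_inv, actRoot_mul, ← fracAct_rootRat]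
    obtain ⟨r, -, hr⟩ := hp.rootPoly_eq
    rw [rootRat, fracAct_algebraMap, ← map_neg, hr, map_smul, polyAct_rootPoly,
      actRoot_weylRefl_self, rootPoly_negRoot, smul_neg]
  have hTy : b.tauCoeff θ ω lam a T y = rootRat P (actRoot P y⁻¹ a).1 ^
      ω ((b.simpleRefl θ a * y) • lam) a * T (b.simpleRefl θ a * y) := by
    rw [b.tauCoeff_apply hω, if_neg hk', sub_zero]
  have hTw : b.tauCoeff θ ω lam a T (y * weylRefl P e) =
      rootRat P (actRoot P (y * weylRefl P e)⁻¹ a).1 ^ ω ((b.simpleRefl θ a * y) • lam) a *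
        T (b.simpleRefl θ a * y * weylRefl P e) := by
    rw [b.tauCoeff_apply hω, ← mul_assoc, mul_smul _ (weylRefl P e), hlam, if_neg hk', sub_zero]
  have hTw' : b.tauCoeff θ ω lam a T (y * weylRefl P e) =
      rootRat P (actRoot P y⁻¹ a).1 ^ ω ((b.simpleRefl θ a * y) • lam) a *
        ((-1) ^ ω ((b.simpleRefl θ a * y) • lam) a *
          T (b.simpleRefl θ a * y * weylRefl P e)) := by
    rw [hTw, hw, neg_eq_neg_one_mul, mul_zpow]
    ring
  constructor
  · have := b.invSum_le hθ hω hgen lam a hpw (by rwa [mul_smul, hlam])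
    rw [hTw]
    refine locOrd_mul_of_le (hpw.rootRat_zpow_mem _) hT.refl_mem ?_
    rwa [← mul_assoc, mul_smul _ (weylRefl P e), hlam] at this
  · have := b.invSum_le hθ hω hgen lam a hp hk
    rw [hTw]
    exact locOrd_mul_of_le (hpw.rootRat_zpow_mem _) hT.refl_mem' (by omega)
  · rcases b.mem_affPos_or hθ (actRoot_mem P y⁻¹ (b.affSimple_subset θ a.2)) with h | h
    · have hnu := b.invSum_simpleRefl_mul hθ hω hgen lam a h hp
      -- If both orders vanish the congruence is transported unchanged. Otherwise they add up to at
      -- least 1, which makes up for the one order that each coefficient may lack.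
      by_cases hkk : ω (y • lam) a = 0 ∧ ω ((b.simpleRefl θ a * y) • lam) a = 0
      · rw [hTw', hTy, hkk.2, zpow_zero, zpow_zero, one_mul, one_mul, one_mul]
        have := hT.sub_mem
        rwa [hnu, hkk.1, add_zero] at this
      · rw [hTw', hTy]
        refine sub_mem ?_ (neg_one_zpow_mul_mem _ ?_)
        · exact locOrd_mul_of_le (hp.rootRat_zpow_mem _) hT.mem (by omega)
        · exact locOrd_mul_of_le (hp.rootRat_zpow_mem _)
            (neg_one_zpow_mul_mem _ hT.refl_mem') (by omega)
    · have hnu := b.invSum_simpleRefl_mul' hθ hω hgen lam a h hp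
      -- Crossing the root shifts `invSum` by its order `k`, and `s_e` contributes another `(-1)^k`;
      -- the two signs cancel.
      have hsign : ((-1 : RatFun M)) ^ (b.invSum θ (ω lam) (e : ι × ℤ).1 y -
          b.wallSum θ (ω lam) e) * (-1) ^ ω ((b.simpleRefl θ a * y) • lam) a =
          (-1) ^ (b.invSum θ (ω lam) (e : ι × ℤ).1 (b.simpleRefl θ a * y) -
            b.wallSum θ (ω lam) e) := by
        rw [← zpow_add₀ (by norm_num), hnu]
        rw [show ∀ p q r : ℤ, p + q - r + q = p - r + 2 * q from fun p q r => by ring,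
          zpow_add₀ (by norm_num), zpow_mul]
        norm_num
      rw [hTw', hTy, mul_left_comm, ← mul_sub, ← mul_assoc, hsign]
      exact locOrd_mul_of_le (hp.rootRat_zpow_mem _) hT.sub_mem (by omega)

lemma IsAdmissible.tauCoeff (hT : b.IsAdmissible θ (ω lam) T) :
    b.IsAdmissible θ (ω lam) (b.tauCoeff θ ω lam a T) where
  denom z := by
    rw [b.tauCoeff_apply hω]
    refine mul_mem (rootRat_zpow_mem_rootDenom _ _) (sub_mem (hT.denom _) ?_)
    split_ifs
    · exact hT.denom _
    · exact zero_mem _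
  free i hi z := b.tauCoeff_free hθ hω hgen lam a hT i hi z
  wall e he hv y hye := by
    by_cases hya : actRoot P y⁻¹ a = e
    · exact b.tauCoeff_wall_self hθ hω hgen lam a he hv (hT.wall e he hv y hye) hya
    -- The root `ye` stays positive under `s_a` unless it equals `a`, the case just treated.
    have hT2 := hT.wall e he hv (b.simpleRefl θ a * y) (by
      rw [actRoot_mul]
      refine b.actRoot_simpleRefl_mem hθ a hye fun h => hya ?_
      rw [← h, actRoot_inv_actRoot])
    by_cases hp : Par P (e : ι × ℤ).1 (actRoot P y⁻¹ a)
    · exact b.tauCoeff_wall_par hθ hω hgen lam a he hv hye hT2 hya hp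
    · exact b.tauCoeff_wall_not_par hθ hω lam a he hv hT2 (hT.wall e he hv y hye) hp

end TauAdmissible

end SimpleSystem

end QDHA

namespace QDHA

variable {ι M N : Type*} [AddCommGroup M] [Module ℝ M] [AddCommGroup N] [Module ℝ N]
variable {P : RootPairing ι ℝ M N}

/-! ### Operators represented by coefficients -/

section CoeffEval

variable {lam0 : N}

/-- The value at `f` of the operator `∑ z ∘ T z` with source the factor of index `λ`. -/
def coeffEval (lam : Orbit P lam0) (f : PolyFun M) :
    (affineWeyl P →₀ RatFun M) →+ (Orbit P lam0 →₀ RatFun M) :=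
  Finsupp.liftAddHom fun z => (Finsupp.singleAddHom (z • lam)).comp
    ((fracAct P z : RatFun M →+ RatFun M).comp
      (AddMonoidHom.mulRight (algebraMap (PolyFun M) (RatFun M) f)))

lemma coeffEval_single (lam : Orbit P lam0) (f : PolyFun M) (z : affineWeyl P) (g : RatFun M) :
    coeffEval lam f (Finsupp.single z g) =
      Finsupp.single (z • lam) (fracAct P z (g * algebraMap (PolyFun M) (RatFun M) f)) := by
  simp [coeffEval]

/-- The left multiplication by `h ∈ ℂ[V]` on operators `∑ z ∘ T z`. -/
def polyMul (h : PolyFun M) : (affineWeyl P →₀ RatFun M) →ₗ[RatFun M] (affineWeyl P →₀ RatFun M) :=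
  Finsupp.lsum (RatFun M) fun z =>
    algebraMap (PolyFun M) (RatFun M) (polyAct P z⁻¹ h) • Finsupp.lsingle z

lemma polyMul_single (h : PolyFun M) (z : affineWeyl P) (g : RatFun M) :
    polyMul h (Finsupp.single z g) =
      Finsupp.single z (algebraMap (PolyFun M) (RatFun M) (polyAct P z⁻¹ h) * g) := by
  rw [polyMul, Finsupp.lsum_single, LinearMap.smul_apply, Finsupp.lsingle_apply,
    Finsupp.smul_single, smul_eq_mul]

lemma polyMul_apply (h : PolyFun M) (T : affineWeyl P →₀ RatFun M) (z : affineWeyl P) :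
    polyMul h T z = algebraMap (PolyFun M) (RatFun M) (polyAct P z⁻¹ h) * T z := by
  classical
  induction T using Finsupp.induction_linear with
  | zero => simp
  | add T T' h h' => rw [map_add, Finsupp.add_apply, h, h', Finsupp.add_apply, mul_add]
  | single w g =>
    rw [polyMul_single]
    by_cases hw : w = z
    · subst hw; simp
    · simp [Finsupp.single_eq_of_ne (Ne.symm hw)]

lemma coeffEval_polyMul (lam : Orbit P lam0) (f h : PolyFun M) (T : affineWeyl P →₀ RatFun M)
    (mu : Orbit P lam0) : coeffEval lam f (polyMul h T) mu =
      algebraMap (PolyFun M) (RatFun M) h * coeffEval lam f T mu := by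
  classical
  induction T using Finsupp.induction_linear with
  | zero => simp
  | add T T' h h' => rw [map_add, map_add, Finsupp.add_apply, h, h', map_add, Finsupp.add_apply,
      mul_add]
  | single w g =>
    rw [polyMul_single, coeffEval_single, coeffEval_single, mul_assoc, map_mul, fracAct_algebraMap,
      polyAct_apply_inv]
    by_cases hw : w • lam = mu
    · subst hw; simp
    · simp [Finsupp.single_eq_of_ne (Ne.symm hw)]

/-- Elements with different `zλ` land in different factors. Those with the same `zλ` give distinct
characters of the multiplicative monoid `ℂ[V]`, and distinct characters are linearly independent. -/
lemma eq_zero_of_coeffEval_eq_zero (lam : Orbit P lam0) {T : affineWeyl P →₀ RatFun M}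
    (h : ∀ f, coeffEval lam f T = 0) : T = 0 := by
  classical
  ext w
  let χ : affineWeyl P → PolyFun M →* RatFun M := fun z =>
    ((algebraMap (PolyFun M) (RatFun M)).comp (polyAct P z : PolyFun M →+* PolyFun M) :
      PolyFun M →* RatFun M)
  have hχ : ∀ z f, χ z f = algebraMap (PolyFun M) (RatFun M) (polyAct P z f) := fun z f => rfl
  let s : Finset (affineWeyl P) := T.support.filter fun z => z • lam = w • lam
  have hinj : Set.InjOn χ s := by
    intro z hz v hv hzv
    refine eq_of_polyAct_eq (lam := (lam : N)) (fun f => ?_) ?_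
    · apply FaithfulSMul.algebraMap_injective (PolyFun M) (RatFun M)
      rw [← hχ, ← hχ, hzv]
    · have := (Finset.mem_filter.1 hz).2.trans (Finset.mem_filter.1 hv).2.symm
      simpa [MulAction.orbit.coe_smul] using congrArg Subtype.val this
  have hli := (linearIndependent_monoidHom (PolyFun M) (RatFun M)).comp
    (fun z : s => χ z) (fun z v hzv => Subtype.ext (hinj z.2 v.2 hzv))
  rw [Fintype.linearIndependent_iff] at hli
  have hsum : ∀ f, ∑ z ∈ s, fracAct P z (T z) * χ z f = 0 := by
    intro f
    have h1 := DFunLike.congr_fun (h f) (w • lam)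
    rw [coeffEval, Finsupp.liftAddHom_apply, Finsupp.sum, Finsupp.finsetSum_apply, Finsupp.zero_apply] at h1
    rw [Finset.sum_filter]
    convert h1 using 2 with z hz
    simp only [AddMonoidHom.comp_apply, Finsupp.singleAddHom_apply, Finsupp.single_apply]
    split_ifs
    · rw [hχ, ← fracAct_algebraMap, ← map_mul]
      rfl
    · rfl
  by_cases hw : w ∈ T.support
  · have h2 := hli (fun z => fracAct P z (T z)) (by
      ext f
      have := hsum f
      rw [← Finset.sum_coe_sort] at this
      simpa using this) ⟨w, Finset.mem_filter.2 ⟨hw, rfl⟩⟩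
    exact (map_eq_zero_iff _ (fracAct P w).injective).1 h2
  · simpa using hw

/-- The operator `A` is given by the coefficients `T` on the factor of index `λ`. -/
def Represents (lam : Orbit P lam0) (T : affineWeyl P →₀ RatFun M)
    (A : Module.End ℂ (Pol P lam0)) : Prop :=
  ∀ f mu, algebraMap (PolyFun M) (RatFun M) (A (Finsupp.single lam f) mu) = coeffEval lam f T mu

lemma idem_single (lam : Orbit P lam0) (f : PolyFun M) :
    idem P lam (Finsupp.single lam f) = Finsupp.single lam f := by simp [idem]

lemma idem_single_of_ne {lam mu : Orbit P lam0} (h : lam ≠ mu) (f : PolyFun M) :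
    idem P mu (Finsupp.single lam f) = 0 := by
  simp [idem, Finsupp.single_eq_of_ne h.symm]

lemma idem_apply (lam mu : Orbit P lam0) (p : Pol P lam0) [Decidable (mu = lam)] :
    idem P lam p mu = if mu = lam then p mu else 0 := by
  split_ifs with h
  · subst h; simp [idem]
  · simp [idem, Finsupp.single_eq_of_ne h]

namespace Represents

variable {lam : Orbit P lam0} {T T' : affineWeyl P →₀ RatFun M} {A B : Module.End ℂ (Pol P lam0)}

lemma one (lam : Orbit P lam0) : Represents lam (Finsupp.single 1 1) (1 : Module.End ℂ (Pol P lam0)) := by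
  classical
  intro f mu
  rw [coeffEval_single, one_smul, one_mul, fracAct_one, Module.End.one_apply,
    Finsupp.single_apply, Finsupp.single_apply, apply_ite (algebraMap (PolyFun M) (RatFun M)),
    map_zero]

lemma zero : Represents lam 0 (0 : Module.End ℂ (Pol P lam0)) := fun f mu => by simp

lemma add (h : Represents lam T A) (h' : Represents lam T' B) : Represents lam (T + T') (A + B) :=
  fun f mu => by
    rw [LinearMap.add_apply, Finsupp.add_apply, map_add, h, h', map_add, Finsupp.add_apply]

lemma sum {κ : Type*} (s : Finset κ) {T : κ → affineWeyl P →₀ RatFun M}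
    {A : κ → Module.End ℂ (Pol P lam0)} (h : ∀ k ∈ s, Represents lam (T k) (A k)) :
    Represents lam (∑ k ∈ s, T k) (∑ k ∈ s, A k) := by
  classical
  induction s using Finset.induction_on with
  | empty => exact zero
  | insert k s hk ih =>
    rw [Finset.sum_insert hk, Finset.sum_insert hk]
    exact (h k (Finset.mem_insert_self k s)).add
      (ih fun j hj => h j (Finset.mem_insert_of_mem hj))

lemma smul (h : Represents lam T A) (g : PolyFun M) : Represents lam (polyMul g T) (g • A) :=
  fun f mu => by
    rw [LinearMap.smul_apply, Finsupp.smul_apply, smul_eq_mul, map_mul, h, coeffEval_polyMul]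

lemma mul_idem (h : Represents lam T A) : Represents lam T (A * idem P lam) :=
  fun f mu => by rw [Module.End.mul_apply, idem_single, h]

lemma mul_idem_of_ne {mu : Orbit P lam0} (h : lam ≠ mu) : Represents lam 0 (A * idem P mu) :=
  fun f nu => by rw [Module.End.mul_apply, idem_single_of_ne h]; simp

open Classical in
lemma idem_mul (h : Represents lam T A) (mu : Orbit P lam0) :
    Represents lam (T.filter fun z => z • lam = mu) (idem P mu * A) := by
  intro f nu
  rw [Module.End.mul_apply, idem_apply]
  have key : coeffEval lam f (T.filter fun z => z • lam = mu) nu =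
      if nu = mu then coeffEval lam f T nu else 0 := by
    clear h
    induction T using Finsupp.induction_linear with
    | zero => rw [Finsupp.filter_zero]; simp
    | add T T' h h' =>
      rw [Finsupp.filter_add, map_add, Finsupp.add_apply, h, h', map_add, Finsupp.add_apply]
      split_ifs <;> simp
    | single w g =>
      by_cases hw : w • lam = mu
      · rw [Finsupp.filter_single_of_pos (p := fun z => z • lam = mu) hw, coeffEval_single, hw]
        split_ifs with h
        · rfl
        · exact Finsupp.single_eq_of_ne h
      · rw [Finsupp.filter_single_of_neg (p := fun z => z • lam = mu) hw, coeffEval_single]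
        split_ifs with h
        · rw [Finsupp.single_eq_of_ne]
          · simp
          · rintro rfl
            exact hw h
        · simp
  rw [key]
  split_ifs
  · exact h f nu
  · simp

lemma mul_idem_eq (h : Represents lam T A) (h' : Represents lam T B) :
    A * idem P lam = B * idem P lam := by
  refine LinearMap.ext fun p => ?_
  have : idem P lam p = Finsupp.single lam (p lam) := by simp [idem]
  rw [Module.End.mul_apply, Module.End.mul_apply, this]
  ext mu
  apply FaithfulSMul.algebraMap_injective (PolyFun M) (RatFun M)
  rw [h, h']

lemma eq_zero (h : Represents lam T (0 : Module.End ℂ (Pol P lam0))) : T = 0 :=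
  eq_zero_of_coeffEval_eq_zero lam fun f => Finsupp.ext fun mu => by rw [← h]; simp

end Represents

end CoeffEval

lemma algebraMap_tauPoly (P : RootPairing ι ℝ M N) (i : ι) {k : ℤ} (hk : -1 ≤ k) (f : PolyFun M) :
    algebraMap (PolyFun M) (RatFun M) (tauPoly P i k f) = rootRat P i ^ k *
      (algebraMap (PolyFun M) (RatFun M) (reflPoly P i f) -
        if k = -1 then algebraMap (PolyFun M) (RatFun M) f else 0) := by
  rw [tauPoly]
  split_ifs with h
  · subst h
    rw [← map_sub, ← rootPoly_mul_demazure, map_mul, ← rootRat, zpow_neg_one,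
      inv_mul_cancel_left₀ (rootRat_ne_zero P i)]
  · obtain ⟨m, rfl⟩ := Int.eq_ofNat_of_zero_le (by omega : 0 ≤ k)
    simp [rootRat]

/-! ### The operators `τ_a` and the algebra they generate -/

namespace SimpleSystem

variable (b : SimpleSystem P) {θ : ι} {lam0 : N} {ω : Orbit P lam0 → ι × ℤ → ℤ}

lemma tau_single (a : b.affSimple θ) (lam : Orbit P lam0) (f : PolyFun M) :
    b.tau θ ω a (Finsupp.single lam f) =
      Finsupp.single (b.simpleRefl θ a • lam) (tauPoly P (a : ι × ℤ).1 (ω lam a) f) := by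
  rw [tau, Finsupp.lsum_single]
  rfl

lemma tau_apply (a : b.affSimple θ) (p : Pol P lam0) (mu : Orbit P lam0) :
    b.tau θ ω a p mu = tauPoly P (a : ι × ℤ).1 (ω (b.simpleRefl θ a • mu) a)
      (p (b.simpleRefl θ a • mu)) := by
  classical
  have hs : ∀ nu : Orbit P lam0, b.simpleRefl θ a • b.simpleRefl θ a • nu = nu := fun nu => by
    rw [← mul_smul, simpleRefl_mul_self, one_smul]
  induction p using Finsupp.induction_linear with
  | zero => simp
  | add p q hp hq => rw [map_add, Finsupp.add_apply, hp, hq, Finsupp.add_apply, map_add]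
  | single lam f =>
    rw [tau_single]
    by_cases h : b.simpleRefl θ a • lam = mu
    · subst h
      rw [hs, Finsupp.single_eq_same, Finsupp.single_eq_same]
    · rw [Finsupp.single_eq_of_ne (Ne.symm h), Finsupp.single_eq_of_ne, map_zero]
      rintro rfl
      exact h (hs mu)

lemma smul_idem_mul (f : PolyFun M) (lam : Orbit P lam0) (A : Module.End ℂ (Pol P lam0)) :
    (f • idem P lam) * A = f • (idem P lam * A) := LinearMap.ext fun _ => rfl

/-- Needed to write an element `x` of the algebra as a finite sum of the `x e(λ)`. -/
lemma exists_finset_mul_idem_eq_zero {x : Module.End ℂ (Pol P lam0)}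
    (hx : x ∈ b.quiverDoubleHecke θ ω) :
    ∃ F : Finset (Orbit P lam0), ∀ lam ∉ F, x * idem P lam = 0 := by
  classical
  have horth : ∀ lam mu : Orbit P lam0, mu ≠ lam → idem P lam * idem P mu = 0 := by
    intro lam mu h
    refine LinearMap.ext fun p => ?_
    simp [idem, Finsupp.single_eq_of_ne h.symm]
  induction hx using NonUnitalAlgebra.adjoin_induction with
  | mem x hx =>
    rcases hx with ⟨f, lam, rfl⟩ | ⟨a, lam, rfl⟩
    · refine ⟨{lam}, fun mu hmu => ?_⟩
      rw [smul_idem_mul, horth lam mu (by simpa using hmu), smul_zero]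
    · refine ⟨{lam}, fun mu hmu => ?_⟩
      rw [mul_assoc, horth lam mu (by simpa using hmu), mul_zero]
  | add x y _ _ hx hy =>
    obtain ⟨F, hF⟩ := hx
    obtain ⟨G, hG⟩ := hy
    refine ⟨F ∪ G, fun lam h => ?_⟩
    rw [Finset.mem_union, not_or] at h
    rw [add_mul, hF lam h.1, hG lam h.2, add_zero]
  | zero => exact ⟨∅, fun lam _ => zero_mul _⟩
  | mul x y _ _ _ hy =>
    obtain ⟨G, hG⟩ := hy
    exact ⟨G, fun lam h => by rw [mul_assoc, hG lam h, mul_zero]⟩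
  | smul r x _ hx =>
    obtain ⟨F, hF⟩ := hx
    exact ⟨F, fun lam h => by rw [smul_mul_assoc, hF lam h, smul_zero]⟩

lemma smul_mem_quiverDoubleHecke {x : Module.End ℂ (Pol P lam0)}
    (hx : x ∈ b.quiverDoubleHecke θ ω) (f : PolyFun M) : f • x ∈ b.quiverDoubleHecke θ ω := by
  have hgen : ∀ (f : PolyFun M) (lam : Orbit P lam0),
      f • idem P lam ∈ b.quiverDoubleHecke θ ω := fun f lam =>
    NonUnitalAlgebra.subset_adjoin ℂ (Or.inl ⟨f, lam, rfl⟩)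
  induction hx using NonUnitalAlgebra.adjoin_induction with
  | mem x hx =>
    rcases hx with ⟨g, lam, rfl⟩ | ⟨a, lam, rfl⟩
    · rw [smul_smul]
      exact hgen _ _
    -- Inserting the projector of the target factor turns `f τ_a e(λ)` into a product of two
    -- generators.
    · have h1 : idem P (b.simpleRefl θ a • lam) * (b.tau θ ω a * idem P lam) =
          b.tau θ ω a * idem P lam := by
        refine LinearMap.ext fun p => ?_
        have : idem P lam p = Finsupp.single lam (p lam) := by simp [idem]
        rw [Module.End.mul_apply, Module.End.mul_apply, this, tau_single, idem_single]
      rw [← h1, ← smul_idem_mul]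
      exact mul_mem (hgen _ _) (NonUnitalAlgebra.subset_adjoin ℂ (Or.inr ⟨a, lam, rfl⟩))
  | add x y _ _ hx hy => rw [smul_add]; exact add_mem hx hy
  | zero => rw [smul_zero]; exact zero_mem _
  | mul x y _ hy' hx _ =>
    have : f • (x * y) = (f • x) * y := LinearMap.ext fun _ => rfl
    rw [this]
    exact mul_mem hx hy'
  | smul r x _ hx =>
    have : f • r • x = r • f • x := LinearMap.ext fun p => by
      simp only [LinearMap.smul_apply]
      rw [smul_comm]
    rw [this]
    exact SMulMemClass.smul_mem r hx

lemma tauWord_single (L : List (b.affSimple θ)) (lam : Orbit P lam0) (f : PolyFun M) :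
    ∃ g, b.tauWord θ ω L (Finsupp.single lam f) =
      Finsupp.single ((L.map (b.simpleRefl θ)).prod • lam) g := by
  induction L with
  | nil => exact ⟨f, by simp [tauWord]⟩
  | cons a L ih =>
    obtain ⟨g, hg⟩ := ih
    refine ⟨tauPoly P (a : ι × ℤ).1 (ω ((L.map (b.simpleRefl θ)).prod • lam) a) g, ?_⟩
    rw [List.map_cons, List.prod_cons, mul_smul, ← tau_single, ← hg]
    rfl

lemma tauWord_mul_idem_mem (L : List (b.affSimple θ)) (lam : Orbit P lam0) :
    b.tauWord θ ω L * idem P lam ∈ b.quiverDoubleHecke θ ω := by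
  induction L with
  | nil =>
    have : b.tauWord θ ω [] * idem P lam = (1 : PolyFun M) • idem P lam := by simp [tauWord]
    rw [this]
    exact NonUnitalAlgebra.subset_adjoin ℂ (Or.inl ⟨1, lam, rfl⟩)
  | cons a L ih =>
    have : b.tauWord θ ω (a :: L) * idem P lam =
        (b.tau θ ω a * idem P ((L.map (b.simpleRefl θ)).prod • lam)) *
          (b.tauWord θ ω L * idem P lam) := by
      refine LinearMap.ext fun p => ?_
      have h1 : idem P lam p = Finsupp.single lam (p lam) := by simp [idem]
      obtain ⟨g, hg⟩ := b.tauWord_single (ω := ω) L lam (p lam)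
      simp only [Module.End.mul_apply]
      rw [h1, hg, idem_single, ← hg]
      rfl
    rw [this]
    exact mul_mem (NonUnitalAlgebra.subset_adjoin ℂ (Or.inr ⟨a, _, rfl⟩)) ih

variable [P.IsCrystallographic]

lemma coeffEval_tauCoeff (hω : b.IsOrderFamily θ lam0 ω) (lam : Orbit P lam0) (a : b.affSimple θ)
    (f : PolyFun M) (T : affineWeyl P →₀ RatFun M) (mu : Orbit P lam0) :
    coeffEval lam f (b.tauCoeff θ ω lam a T) mu =
      rootRat P (a : ι × ℤ).1 ^ ω (b.simpleRefl θ a • mu) a *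
        (fracAct P (b.simpleRefl θ a) (coeffEval lam f T (b.simpleRefl θ a • mu)) -
          if ω (b.simpleRefl θ a • mu) a = -1 then coeffEval lam f T mu else 0) := by
  classical
  have hs : ∀ nu : Orbit P lam0, b.simpleRefl θ a • b.simpleRefl θ a • nu = nu := fun nu => by
    rw [← mul_smul, simpleRefl_mul_self, one_smul]
  induction T using Finsupp.induction_linear with
  | zero => simp
  | add T T' h h' =>
    simp only [map_add, Finsupp.add_apply, h, h']
    split_ifs <;> ring
  | single w g =>
    have hf : ∀ (z : affineWeyl P) (k : ℤ) (x y : RatFun M),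
        fracAct P z (rootRat P (actRoot P z⁻¹ a).1 ^ k * x * y) =
          rootRat P (a : ι × ℤ).1 ^ k * fracAct P z (x * y) := fun z k x y => by
      rw [mul_assoc, map_mul, map_zpow₀, fracAct_rootRat, actRoot_actRoot_inv]
    rw [tauCoeff_single, map_sub, Finsupp.sub_apply, coeffEval_single, mul_sub, hf,
      coeffEval_single, mul_smul]
    congr 1
    · by_cases hw : b.simpleRefl θ a • w • lam = mu
      · subst hw
        rw [hs, Finsupp.single_eq_same, Finsupp.single_eq_same, fracAct_mul]
      · rw [Finsupp.single_eq_of_ne (Ne.symm hw), Finsupp.single_eq_of_ne, map_zero, mul_zero]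
        intro h
        rw [← h, hs] at hw
        exact hw rfl
    · by_cases hw : w • lam = mu
      · subst hw
        by_cases h : ω (w • lam) a = -1
        · rw [hω.simpleRefl_smul a h, if_pos h, if_pos h, coeffEval_single, hf, h,
            Finsupp.single_eq_same, Finsupp.single_eq_same]
        · rw [if_neg h, if_neg (by rwa [hω.eq_neg_one_iff])]
          simp
      · rw [Finsupp.single_eq_of_ne (Ne.symm hw), ite_self, mul_zero]
        split_ifs
        · rw [coeffEval_single, Finsupp.single_eq_of_ne (Ne.symm hw)]
        · simp

lemma represents_tau_mul (hω : b.IsOrderFamily θ lam0 ω) {lam : Orbit P lam0} (a : b.affSimple θ)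
    {T : affineWeyl P →₀ RatFun M} {A : Module.End ℂ (Pol P lam0)} (h : Represents lam T A) :
    Represents lam (b.tauCoeff θ ω lam a T) (b.tau θ ω a * A) := by
  intro f mu
  rw [Module.End.mul_apply, tau_apply, algebraMap_tauPoly _ _ (hω.neg_one_le_simple a _),
    b.coeffEval_tauCoeff hω, ← h, ← h, fracAct_algebraMap, simpleRefl_eq, polyAct_weylRefl]
  by_cases hk : ω (b.simpleRefl θ a • mu) a = -1
  · rw [← simpleRefl_eq, hω.simpleRefl_smul' a hk]
  · rw [← simpleRefl_eq, if_neg hk, if_neg hk]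

end SimpleSystem

end QDHA

namespace QDHA

variable {ι M N : Type*} [AddCommGroup M] [Module ℝ M] [AddCommGroup N] [Module ℝ N]
variable {P : RootPairing ι ℝ M N}

namespace SimpleSystem

variable (b : SimpleSystem P) {θ : ι} [P.IsCrystallographic]

/-! ### Closure properties of admissible families -/

namespace IsAdmissible

variable {b} {v : ι × ℤ → ℤ} {T T' : affineWeyl P →₀ RatFun M}

lemma add (h : b.IsAdmissible θ v T) (h' : b.IsAdmissible θ v T') :
    b.IsAdmissible θ v (T + T') where
  denom z := add_mem (h.denom z) (h'.denom z)
  free i hi z := add_mem (h.free i hi z) (h'.free i hi z)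
  wall e he hv y hy := by
    obtain ⟨h1, h2, h3⟩ := h.wall e he hv y hy
    obtain ⟨h1', h2', h3'⟩ := h'.wall e he hv y hy
    refine ⟨add_mem h1 h1', add_mem h2 h2', ?_⟩
    convert add_mem h3 h3' using 1
    simp only [Finsupp.add_apply]
    ring

lemma zero : b.IsAdmissible θ v (0 : affineWeyl P →₀ RatFun M) where
  denom _ := zero_mem _
  free _ _ _ := zero_mem _
  wall e _ _ _ _ := ⟨zero_mem _, zero_mem _, by simp⟩

lemma polyMul (h : b.IsAdmissible θ v T) (g : PolyFun M) :
    b.IsAdmissible θ v (polyMul g T) where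
  denom z := by
    rw [polyMul_apply]
    exact mul_mem (algebraMap_mem_rootDenom _) (h.denom z)
  free i hi z := by
    rw [polyMul_apply]
    exact locOrd_mul_of_le (algebraMap_mem_locOrd i _) (h.free i hi z) (zero_add _).ge
  wall e he hv y hy := by
    obtain ⟨h1, h2, h3⟩ := h.wall e he hv y hy
    refine ⟨?_, ?_, ?_⟩
    · rw [polyMul_apply]
      exact locOrd_mul_of_le (algebraMap_mem_locOrd _ _) h1 (zero_add _).ge
    · rw [polyMul_apply]
      exact locOrd_mul_of_le (algebraMap_mem_locOrd _ _) h2 (zero_add _).ge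
    · rw [polyMul_apply, polyMul_apply, mul_inv_rev, weylRefl_inv, polyAct_mul, polyAct_weylRefl,
        AlgHom.comp_apply]
      -- The multipliers at `y` and `y s_e` are exchanged by `s_e`, hence congruent modulo `e`; the
      -- error term is absorbed by `refl_mem'`.
      have hd := algebraMap_mem_locOrd_one ((dvd_sub_comm).1 (rootPoly_dvd P (e : ι × ℤ).1
        (polyAct P y⁻¹ g)))
      have h4 := locOrd_mul_of_le (n := b.invSum θ v (e : ι × ℤ).1 y) hd
        (neg_one_zpow_mul_mem (b.invSum θ v (e : ι × ℤ).1 y - b.wallSum θ v e) h2) (by omega)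
      have h5 := locOrd_mul_of_le (algebraMap_mem_locOrd _ (polyAct P y⁻¹ g)) h3 (zero_add _).ge
      convert add_mem h5 h4 using 1
      rw [map_sub]
      ring

lemma sum {κ : Type*} (s : Finset κ) {T : κ → affineWeyl P →₀ RatFun M}
    (h : ∀ k ∈ s, b.IsAdmissible θ v (T k)) : b.IsAdmissible θ v (∑ k ∈ s, T k) := by
  classical
  induction s using Finset.induction_on with
  | empty => exact zero
  | insert k s hk ih =>
    rw [Finset.sum_insert hk]
    exact (h k (Finset.mem_insert_self k s)).add
      (ih fun j hj => h j (Finset.mem_insert_of_mem hj))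

lemma neg (h : b.IsAdmissible θ v T) : b.IsAdmissible θ v (-T) := by
  convert h.polyMul (-1) using 1
  ext z
  rw [polyMul_apply]
  simp

lemma single_one (hθ : b.IsHighest θ) :
    b.IsAdmissible θ v (Finsupp.single (1 : affineWeyl P) (1 : RatFun M)) where
  denom z := by
    classical
    rw [Finsupp.single_apply]
    split_ifs
    exacts [one_mem _, zero_mem _]
  free i _ z := by
    classical
    rw [Finsupp.single_apply]
    split_ifs with h
    · rw [← h, b.invSum_one _ _ _ hθ]
      exact one_mem_locOrd i
    · exact zero_mem _
  wall e he _ y hy := by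
    classical
    -- The identity is never the reflected member of a pair: `y s_e = 1` would make `ye = -e`
    -- negative.
    have h1 : (Finsupp.single (1 : affineWeyl P) (1 : RatFun M)) (y * weylRefl P e) = 0 := by
      apply Finsupp.single_eq_of_ne
      intro h
      rw [eq_inv_of_mul_eq_one_left h, weylRefl_inv, actRoot_weylRefl_self] at hy
      exact b.negRoot_notMem_affPos hθ he hy
    refine ⟨h1 ▸ zero_mem _, h1 ▸ zero_mem _, ?_⟩
    rw [h1, mul_zero, sub_zero, Finsupp.single_apply]
    split_ifs with h
    · rw [← h, b.invSum_one _ _ _ hθ]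
      exact one_mem_locOrd _
    · exact zero_mem _

/-- Serves left multiplication by `e(μ)`, which keeps the `z` with `zλ = μ`; this set is stable
under right multiplication by `s_e` because `s_e` fixes `λ`. -/
lemma filter (h : b.IsAdmissible θ v T) (p : affineWeyl P → Prop) [DecidablePred p]
    (hp : ∀ e : affineRoots P, (e : ι × ℤ) ∈ b.affPos θ → v e = -1 → ∀ y,
      p (y * weylRefl P e) ↔ p y) : b.IsAdmissible θ v (T.filter p) where
  denom z := by
    rw [Finsupp.filter_apply]
    split_ifs
    exacts [h.denom z, zero_mem _]
  free i hi z := by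
    rw [Finsupp.filter_apply]
    split_ifs
    exacts [h.free i hi z, zero_mem _]
  wall e he hv y hy := by
    obtain ⟨h1, h2, h3⟩ := h.wall e he hv y hy
    by_cases hpy : p y
    · have hpw := (hp e he hv y).2 hpy
      exact ⟨by rwa [Finsupp.filter_apply_pos _ _ hpw], by rwa [Finsupp.filter_apply_pos _ _ hpw],
        by rwa [Finsupp.filter_apply_pos _ _ hpw, Finsupp.filter_apply_pos _ _ hpy]⟩
    · have hpw := mt (hp e he hv y).1 hpy
      refine ⟨?_, ?_, ?_⟩
      · rw [Finsupp.filter_apply_neg _ _ hpw]; exact zero_mem _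
      · rw [Finsupp.filter_apply_neg _ _ hpw]; exact zero_mem _
      · rw [Finsupp.filter_apply_neg _ _ hpw, Finsupp.filter_apply_neg _ _ hpy]; simp

end IsAdmissible

/-! ### Triangularity of reduced words, freeness and spanning -/

variable {lam0 : N} {ω : Orbit P lam0 → ι × ℤ → ℤ}

/-- The coefficients of `τ_{a_l} ⋯ τ_{a_1}` on the factor of index `λ`. -/
def wordCoeff (θ : ι) (ω : Orbit P lam0 → ι × ℤ → ℤ) (lam : Orbit P lam0) :
    List (b.affSimple θ) → (affineWeyl P →₀ RatFun M)
  | [] => Finsupp.single 1 1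
  | a :: L => b.tauCoeff θ ω lam a (wordCoeff θ ω lam L)

lemma represents_tauWord (hω : b.IsOrderFamily θ lam0 ω) (lam : Orbit P lam0)
    (L : List (b.affSimple θ)) :
    Represents lam (b.wordCoeff θ ω lam L) (b.tauWord θ ω L) := by
  induction L with
  | nil => exact Represents.one lam
  | cons a L ih => exact b.represents_tau_mul hω a ih

/-- Each letter either multiplies by `s_a` or, in the Demazure case, may also be skipped, so every
other element of the support has a shorter word. -/
lemma wordCoeff_support (hω : b.IsOrderFamily θ lam0 ω) (lam : Orbit P lam0)
    (L : List (b.affSimple θ)) {y : affineWeyl P} (h : b.wordCoeff θ ω lam L y ≠ 0) :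
    y = (L.map (b.simpleRefl θ)).prod ∨ ∃ L' : List (b.affSimple θ), L'.length < L.length ∧
      (L'.map (b.simpleRefl θ)).prod = y := by
  classical
  induction L generalizing y with
  | nil =>
    left
    by_contra hy
    exact h (Finsupp.single_eq_of_ne hy)
  | cons a L ih =>
    rw [wordCoeff, b.tauCoeff_apply hω] at h
    by_cases h1 : b.wordCoeff θ ω lam L (b.simpleRefl θ a * y) = 0
    · have h2 : b.wordCoeff θ ω lam L y ≠ 0 := by
        intro h2
        rw [h1, h2] at h
        simp at h
      right
      rcases ih h2 with rfl | ⟨L', hL', rfl⟩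
      · exact ⟨L, by simp, rfl⟩
      · exact ⟨L', by rw [List.length_cons]; omega, rfl⟩
    · rcases ih h1 with h2 | ⟨L', hL', h2⟩
      · left
        rw [List.map_cons, List.prod_cons, ← h2, simpleRefl_mul_mul]
      · right
        exact ⟨a :: L', by simpa using hL', by
          rw [List.map_cons, List.prod_cons, h2, simpleRefl_mul_mul]⟩

/-- Each letter of a reduced word adds one inversion and multiplies the leading coefficient by a
power of that root. The bounds concern the inverse because the leading coefficient is to be divided
out. -/
lemma wordCoeff_leading [Finite ι] (hθ : b.IsHighest θ) (hω : b.IsOrderFamily θ lam0 ω)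
    (hgen : ∀ z : affineWeyl P, ∃ L : List (b.affSimple θ), (L.map (b.simpleRefl θ)).prod = z)
    (lam : Orbit P lam0) {L : List (b.affSimple θ)} {w : affineWeyl P}
    (hL : b.IsReducedWord θ L w) : b.wordCoeff θ ω lam L w ≠ 0 ∧
      (b.wordCoeff θ ω lam L w)⁻¹ ∈ rootDenom P ∧
      ∀ i, (b.wordCoeff θ ω lam L w)⁻¹ ∈ locOrd P i (-b.invSum θ (ω lam) i w) := by
  induction L generalizing w with
  | nil =>
    have hw : w = 1 := by simpa using hL.1.symm
    subst hw
    rw [wordCoeff, Finsupp.single_eq_same, inv_one]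
    refine ⟨one_ne_zero, one_mem _, fun i => ?_⟩
    rw [b.invSum_one _ _ _ hθ, neg_zero]
    exact one_mem_locOrd i
  | cons a L ih =>
    have hz := b.actRoot_inv_mem_of_isReducedWord hθ hL
    obtain ⟨h1, h2, h3⟩ := ih (b.isReducedWord_tail hL)
    have hw : b.simpleRefl θ a * (L.map (b.simpleRefl θ)).prod = w := hL.1
    -- By minimality `w` is longer than everything in the support of the tail, so the Demazure
    -- correction does not reach it.
    have h0 : b.wordCoeff θ ω lam L w = 0 := by
      by_contra h
      rcases b.wordCoeff_support hω lam L h with h' | ⟨L', hL', h'⟩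
      · have := hL.2 L h'.symm
        rw [List.length_cons] at this
        omega
      · have := hL.2 L' h'
        rw [List.length_cons] at this
        omega
    set z := (L.map (b.simpleRefl θ)).prod
    have hwz : b.wordCoeff θ ω lam (a :: L) w = (-rootRat P (actRoot P z⁻¹ a).1) ^ ω (z • lam) a *
        b.wordCoeff θ ω lam L z := by
      rw [wordCoeff, b.tauCoeff_apply hω, h0, ite_self, sub_zero, ← hw, simpleRefl_mul_mul,
        actRoot_inv_simpleRefl_mul, rootRat_negRoot]
    have hinv : (b.wordCoeff θ ω lam (a :: L) w)⁻¹ = (-1) ^ (-ω (z • lam) a) *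
        (rootRat P (actRoot P z⁻¹ a).1 ^ (-ω (z • lam) a) * (b.wordCoeff θ ω lam L z)⁻¹) := by
      rw [hwz, mul_inv, ← zpow_neg, neg_eq_neg_one_mul, mul_zpow, mul_assoc]
    refine ⟨?_, ?_, fun i => ?_⟩
    · rw [hwz]
      exact mul_ne_zero (zpow_ne_zero _ (neg_ne_zero.2 (rootRat_ne_zero P _))) h1
    · rw [hinv]
      refine mul_mem ?_ (mul_mem (rootRat_zpow_mem_rootDenom _ _) h2)
      rcases Int.even_or_odd (-ω (z • lam) a) with h | h
      · rw [h.neg_one_zpow]; exact one_mem _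
      · rw [h.neg_one_zpow]; exact neg_mem (one_mem _)
    · rw [hinv]
      apply neg_one_zpow_mul_mem
      by_cases hp : Par P i (actRoot P z⁻¹ a)
      · refine locOrd_mul_of_le (hp.rootRat_zpow_mem _) (h3 i) ?_
        rw [← hw, b.invSum_simpleRefl_mul hθ hω hgen lam a hz hp]
        omega
      · refine locOrd_mul_of_le (rootRat_zpow_mem_of_not_par hp _) (h3 i) ?_
        rw [← hw, b.invSum_of_not_par _ _ hθ a hp]
        omega

variable {red : affineWeyl P → List (b.affSimple θ)}

/-- Suppose the direction contains `e` with `v e = -1`. If `ze > 0`, then `z s_e` is longer, its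
coefficient vanishes and the congruence bounds `T z` alone; if `ze < 0`, then `z` is the reflected
member of its pair. -/
lemma IsAdmissible.mem_locOrd_of_maximal [Finite ι] {b : SimpleSystem P} {v : ι × ℤ → ℤ} (hθ : b.IsHighest θ)
    {red : affineWeyl P → List (b.affSimple θ)} (hred : ∀ w, b.IsReducedWord θ (red w) w)
    {T : affineWeyl P →₀ RatFun M} (hT : b.IsAdmissible θ v T) {z : affineWeyl P}
    (hz : ∀ y, (red z).length < (red y).length → T y = 0) (i : ι) :
    T z ∈ locOrd P i (b.invSum θ v i z) := by
  by_cases hi : ∀ e ∈ b.affPos θ, v e = -1 → ¬ Par P i e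
  · exact hT.free i hi z
  push Not at hi
  obtain ⟨e, he, hv, hp⟩ := hi
  rw [hp.locOrd_eq, b.invSum_congr v i hp]
  let e' : affineRoots P := ⟨e, he.1⟩
  rcases b.mem_affPos_or hθ (actRoot_mem P z he.1) with h | h
  · have h1 := (hT.wall e' he hv z h).sub_mem
    rwa [hz (z * weylRefl P e'), mul_zero, sub_zero] at h1
    obtain ⟨L', hL', h2⟩ := b.exists_shorter_word hθ e' he (red (z * weylRefl P e')) (by
      rw [(hred _).1, actRoot_mul, actRoot_weylRefl_self, actRoot_negRoot, negRoot_negRoot]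
      exact h)
    rw [(hred _).1, mul_assoc, weylRefl_mul_self, mul_one] at h2
    exact ((hred z).2 L' h2).trans_lt hL'
  · have h1 := (hT.wall e' he hv (z * weylRefl P e') (by
      rw [actRoot_mul, actRoot_weylRefl_self, actRoot_negRoot]
      exact h)).refl_mem
    rwa [mul_assoc, weylRefl_mul_self, mul_one] at h1

lemma wordCoeff_red_eq_zero (hω : b.IsOrderFamily θ lam0 ω)
    (hred : ∀ w, b.IsReducedWord θ (red w) w) (lam : Orbit P lam0) {w y : affineWeyl P}
    (h : (red w).length ≤ (red y).length) (hne : y ≠ w) :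
    b.wordCoeff θ ω lam (red w) y = 0 := by
  by_contra h0
  rcases b.wordCoeff_support hω lam _ h0 with h1 | ⟨L', hL', h1⟩
  · exact hne (h1.trans (hred w).1)
  · have := (hred y).2 L' h1
    omega

lemma isAdmissible_wordCoeff [Finite ι] (hθ : b.IsHighest θ) (hω : b.IsOrderFamily θ lam0 ω)
    (hred : ∀ w, b.IsReducedWord θ (red w) w) (lam : Orbit P lam0) (L : List (b.affSimple θ)) :
    b.IsAdmissible θ (ω lam) (b.wordCoeff θ ω lam L) := by
  induction L with
  | nil => exact IsAdmissible.single_one hθ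
  -- The chosen reduced words also witness that the simple reflections generate `W_S`.
  | cons a L ih => exact IsAdmissible.tauCoeff b hθ hω (fun z => ⟨red z, (hred z).1⟩) lam a ih

/-- The `ℂ[V]`-span of the operators `τ_w e(λ)`. -/
def wordSpan (θ : ι) (ω : Orbit P lam0 → ι × ℤ → ℤ) (red : affineWeyl P → List (b.affSimple θ)) :
    Submodule (PolyFun M) (Module.End ℂ (Pol P lam0)) :=
  Submodule.span (PolyFun M) (Set.range fun p : Orbit P lam0 × affineWeyl P =>
    b.tauWord θ ω (red p.2) * idem P p.1)

/-- The coefficients on the top length `n` are polynomial multiples of leading coefficients of the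
`τ_z`. Removing these multiples changes `T` only at shorter elements and preserves admissibility. -/
lemma exists_mem_wordSpan [Finite ι] (hθ : b.IsHighest θ) (hω : b.IsOrderFamily θ lam0 ω)
    (hred : ∀ w, b.IsReducedWord θ (red w) w) (lam : Orbit P lam0) (n : ℕ)
    {T : affineWeyl P →₀ RatFun M} (hT : b.IsAdmissible θ (ω lam) T)
    (hn : ∀ y, n ≤ (red y).length → T y = 0) :
    ∃ A ∈ b.wordSpan θ ω red, Represents lam T A ∧ A * idem P lam = A := by
  classical
  induction n generalizing T with
  | zero =>
    have : T = 0 := Finsupp.ext fun y => hn y (Nat.zero_le _)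
    exact ⟨0, zero_mem _, this ▸ Represents.zero, zero_mul _⟩
  | succ n ih =>
    have hcoef : ∀ z, ∃ g : PolyFun M, (red z).length = n →
        polyMul g (b.wordCoeff θ ω lam (red z)) z = T z := by
      intro z
      by_cases hz : (red z).length = n
      swap
      · exact ⟨0, fun h => absurd h hz⟩
      obtain ⟨h1, h2, h3⟩ := b.wordCoeff_leading hθ hω (fun z => ⟨red z, (hred z).1⟩) lam (hred z)
      obtain ⟨g, hg⟩ := exists_algebraMap_eq (P := P) (mul_mem (hT.denom z) h2) (fun i =>
        locOrd_mul_of_le (hT.mem_locOrd_of_maximal hθ hred (z := z)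
          (fun y hy => hn y (by omega)) i) (h3 i) (by omega))
      -- Left multiplication by a polynomial acts on the coefficient at `z` through `z⁻¹`, hence the
      -- twist.
      refine ⟨polyAct P z g, fun _ => ?_⟩
      rw [polyMul_apply, polyAct_inv_apply, hg, mul_assoc, inv_mul_cancel₀ h1, mul_one]
    choose g hg using hcoef
    let s := T.support.filter fun z => (red z).length = n
    let T' := ∑ z ∈ s, polyMul (g z) (b.wordCoeff θ ω lam (red z))
    have hT' : b.IsAdmissible θ (ω lam) T' := IsAdmissible.sum s fun z _ =>
      (b.isAdmissible_wordCoeff hθ hω hred lam (red z)).polyMul (g z)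
    have hval : ∀ y, n ≤ (red y).length → T' y = T y := by
      intro y hy
      have hzero : ∀ z ∈ s, y ≠ z → polyMul (g z) (b.wordCoeff θ ω lam (red z)) y = 0 := by
        intro z hz hne
        have := (Finset.mem_filter.1 hz).2
        rw [polyMul_apply, b.wordCoeff_red_eq_zero hω hred lam (by omega) hne, mul_zero]
      rw [Finsupp.finsetSum_apply]
      by_cases hys : y ∈ s
      · rw [Finset.sum_eq_single y (fun z hz hne => hzero z hz hne.symm) (fun h => absurd hys h)]
        exact hg y (Finset.mem_filter.1 hys).2
      · rw [Finset.sum_eq_zero fun z hz => hzero z hz (by rintro rfl; exact hys hz)]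
        by_contra h
        rcases hy.eq_or_lt with hy | hy
        · exact hys (Finset.mem_filter.2 ⟨Finsupp.mem_support_iff.2 (Ne.symm h), hy.symm⟩)
        · exact h (hn y hy).symm
    obtain ⟨A, hA, hA', hA2⟩ := ih (T := T + -T') (hT.add hT'.neg) (fun y hy => by
      rw [Finsupp.add_apply, Finsupp.neg_apply, hval y hy, add_neg_cancel])
    refine ⟨A + ∑ z ∈ s, g z • (b.tauWord θ ω (red z) * idem P lam), ?_, ?_, ?_⟩
    · exact add_mem hA (sum_mem fun z _ => Submodule.smul_mem _ _
        (Submodule.subset_span ⟨(lam, z), rfl⟩))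
    · have := hA'.add (Represents.sum s fun z _ =>
        ((b.represents_tauWord hω lam (red z)).mul_idem).smul (g z))
      convert this using 1
      rw [neg_add_cancel_right]
    · rw [add_mul, hA2, Finset.sum_mul]
      congr 1
      refine Finset.sum_congr rfl fun z _ => LinearMap.ext fun p => ?_
      simp [idem]

/-- Among the terms with nonzero coefficient choose one with `w` of maximal length; within its
factor `λ`, only `τ_w` contributes at `w`. -/
lemma linearIndependent_tauWord [Finite ι] (hθ : b.IsHighest θ) (hω : b.IsOrderFamily θ lam0 ω)
    (hred : ∀ w, b.IsReducedWord θ (red w) w) :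
    LinearIndependent (PolyFun M) (fun p : Orbit P lam0 × affineWeyl P =>
      b.tauWord θ ω (red p.2) * idem P p.1) := by
  classical
  suffices key : ∀ (s : Finset (Orbit P lam0 × affineWeyl P)) (c : _ → PolyFun M),
      ∑ p ∈ s, c p • (b.tauWord θ ω (red p.2) * idem P p.1) = 0 → ∀ p ∈ s, c p = 0 by
    refine linearIndependent_iff'ₛ.2 fun s f g hfg p hp => ?_
    refine sub_eq_zero.1 (key s (fun p => f p - g p) ?_ p hp)
    have hsum : ∑ p ∈ s, (f p - g p) • (b.tauWord θ ω (red p.2) * idem P p.1) +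
        ∑ p ∈ s, g p • (b.tauWord θ ω (red p.2) * idem P p.1) =
        ∑ p ∈ s, g p • (b.tauWord θ ω (red p.2) * idem P p.1) := by
      rw [← Finset.sum_add_distrib]
      refine (Finset.sum_congr rfl fun p _ => ?_).trans hfg
      rw [← add_smul, sub_add_cancel]
    exact LinearMap.ext fun v => add_eq_right.1 (LinearMap.congr_fun hsum v)
  intro s c hc
  by_contra! hne
  have hs : (s.filter fun p => c p ≠ 0).Nonempty := by
    obtain ⟨p, hp, hcp⟩ := hne
    exact ⟨p, Finset.mem_filter.2 ⟨hp, hcp⟩⟩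
  obtain ⟨⟨lam, w⟩, hp, hmax⟩ := Finset.exists_max_image _ (fun p => (red p.2).length) hs
  rw [Finset.mem_filter] at hp
  have hrep := Represents.sum (lam := lam) s (A := fun p => c p • (b.tauWord θ ω (red p.2) * idem P p.1))
    (T := fun p => if p.1 = lam then polyMul (c p) (b.wordCoeff θ ω lam (red p.2)) else 0)
    (fun p _ => by
      split_ifs with h
      · rw [h]
        exact ((b.represents_tauWord hω lam _).mul_idem).smul _
      · simpa using (Represents.mul_idem_of_ne (A := b.tauWord θ ω (red p.2))
          (Ne.symm h)).smul (c p))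
  rw [hc] at hrep
  have h0 := DFunLike.congr_fun hrep.eq_zero w
  rw [Finsupp.finsetSum_apply, Finset.sum_eq_single (lam, w)] at h0
  · rw [if_pos rfl, polyMul_apply, Finsupp.zero_apply, mul_eq_zero] at h0
    rcases h0 with h0 | h0
    · rw [FaithfulSMul.algebraMap_eq_zero_iff] at h0
      exact hp.2 (polyAct_injective P w⁻¹ (h0.trans (map_zero _).symm))
    · exact (b.wordCoeff_leading hθ hω (fun z => ⟨red z, (hred z).1⟩) lam (hred w)).1 h0
  · rintro ⟨mu, y⟩ hy hne
    split_ifs with h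
    · dsimp only at h
      subst h
      by_cases hcy : c (mu, y) = 0
      · rw [hcy, polyMul_apply]
        simp
      · have := hmax (mu, y) (Finset.mem_filter.2 ⟨hy, hcy⟩)
        rw [polyMul_apply, b.wordCoeff_red_eq_zero hω hred mu this (by
          rintro rfl
          exact hne rfl), mul_zero]
    · rfl
  · exact fun h => absurd hp.1 h

/-- The operators whose coefficients on each factor are admissible. -/
def IsAdmissibleOp (θ : ι) (ω : Orbit P lam0 → ι × ℤ → ℤ) (A : Module.End ℂ (Pol P lam0)) : Prop :=
  ∀ lam, ∃ T, b.IsAdmissible θ (ω lam) T ∧ Represents lam T A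

/-! ### Admissible operators and the inclusion of the algebra in the span -/

namespace IsAdmissibleOp

variable {b} {A B : Module.End ℂ (Pol P lam0)}

lemma one (hθ : b.IsHighest θ) : b.IsAdmissibleOp θ ω (1 : Module.End ℂ (Pol P lam0)) :=
  fun lam => ⟨_, IsAdmissible.single_one hθ, Represents.one lam⟩

lemma zero : b.IsAdmissibleOp θ ω (0 : Module.End ℂ (Pol P lam0)) :=
  fun _ => ⟨0, IsAdmissible.zero, Represents.zero⟩

lemma add (hA : b.IsAdmissibleOp θ ω A) (hB : b.IsAdmissibleOp θ ω B) :
    b.IsAdmissibleOp θ ω (A + B) := fun lam => by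
  obtain ⟨T, hT, h⟩ := hA lam
  obtain ⟨T', hT', h'⟩ := hB lam
  exact ⟨_, hT.add hT', h.add h'⟩

lemma smul (hA : b.IsAdmissibleOp θ ω A) (f : PolyFun M) : b.IsAdmissibleOp θ ω (f • A) :=
  fun lam => by
    obtain ⟨T, hT, h⟩ := hA lam
    exact ⟨_, hT.polyMul f, h.smul f⟩

lemma idem_mul (hω : b.IsOrderFamily θ lam0 ω) (hA : b.IsAdmissibleOp θ ω A)
    (mu : Orbit P lam0) : b.IsAdmissibleOp θ ω (idem P mu * A) := fun lam => by
  classical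
  obtain ⟨T, hT, h⟩ := hA lam
  refine ⟨_, hT.filter _ fun e he hv y => ?_, h.idem_mul mu⟩
  rw [mul_smul, weylRefl_smul_orbit e lam (hω.eval_eq_zero lam e he hv)]

lemma tau_mul [Finite ι] (hθ : b.IsHighest θ) (hω : b.IsOrderFamily θ lam0 ω)
    (hred : ∀ w, b.IsReducedWord θ (red w) w)
    (hA : b.IsAdmissibleOp θ ω A) (a : b.affSimple θ) :
    b.IsAdmissibleOp θ ω (b.tau θ ω a * A) := fun lam => by
  obtain ⟨T, hT, h⟩ := hA lam
  exact ⟨_, IsAdmissible.tauCoeff b hθ hω (fun z => ⟨red z, (hred z).1⟩) lam a hT,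
    b.represents_tau_mul hω a h⟩

lemma mul_idem_mem [Finite ι] (hθ : b.IsHighest θ) (hω : b.IsOrderFamily θ lam0 ω)
    (hred : ∀ w, b.IsReducedWord θ (red w) w) (hA : b.IsAdmissibleOp θ ω A)
    (lam : Orbit P lam0) : A * idem P lam ∈ b.wordSpan θ ω red := by
  obtain ⟨T, hT, h⟩ := hA lam
  obtain ⟨B, hB, hB', hB2⟩ := b.exists_mem_wordSpan hθ hω hred lam
    (T.support.sup (fun y => (red y).length) + 1) hT (fun y hy => by
      by_contra h0
      have := Finset.le_sup (f := fun y => (red y).length) (Finsupp.mem_support_iff.2 h0)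
      omega)
  rw [h.mul_idem_eq hB', hB2]
  exact hB

end IsAdmissibleOp

/-- Admissibility is controlled only under left multiplication by generators, so the induction on
`x` runs over all admissible `A`. It is then applied to `A = 1`, which need not lie in the algebra.
-/
lemma isAdmissibleOp_mul [Finite ι] (hθ : b.IsHighest θ) (hω : b.IsOrderFamily θ lam0 ω)
    (hred : ∀ w, b.IsReducedWord θ (red w) w) {x : Module.End ℂ (Pol P lam0)}
    (hx : x ∈ b.quiverDoubleHecke θ ω) {A : Module.End ℂ (Pol P lam0)}
    (hA : b.IsAdmissibleOp θ ω A) : b.IsAdmissibleOp θ ω (x * A) := by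
  induction hx using NonUnitalAlgebra.adjoin_induction generalizing A with
  | mem x hx =>
    rcases hx with ⟨f, lam, rfl⟩ | ⟨a, lam, rfl⟩
    · rw [smul_idem_mul]
      exact (hA.idem_mul hω lam).smul f
    · rw [mul_assoc]
      exact IsAdmissibleOp.tau_mul hθ hω hred (hA.idem_mul hω lam) a
  | add x y _ _ hx hy => rw [add_mul]; exact (hx hA).add (hy hA)
  | zero => rw [zero_mul]; exact IsAdmissibleOp.zero
  | mul x y _ _ hx hy => rw [mul_assoc]; exact hx (hy hA)
  | smul r x _ hx =>
    have : r • x * A = (algebraMap ℂ (PolyFun M) r) • (x * A) := by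
      refine LinearMap.ext fun p => ?_
      rw [LinearMap.smul_apply, algebraMap_smul]
      rfl
    rw [this]
    exact (hx hA).smul _

lemma quiverDoubleHecke_le [Finite ι] (hθ : b.IsHighest θ) (hω : b.IsOrderFamily θ lam0 ω)
    (hred : ∀ w, b.IsReducedWord θ (red w) w) {x : Module.End ℂ (Pol P lam0)}
    (hx : x ∈ b.quiverDoubleHecke θ ω) : x ∈ b.wordSpan θ ω red := by
  classical
  obtain ⟨F, hF⟩ := b.exists_finset_mul_idem_eq_zero hx
  have hadm : b.IsAdmissibleOp θ ω x := by
    simpa using b.isAdmissibleOp_mul hθ hω hred hx (IsAdmissibleOp.one hθ)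
  have hsum : x = ∑ lam ∈ F, x * idem P lam := by
    refine Finsupp.lhom_ext fun mu f => ?_
    rw [LinearMap.sum_apply]
    have hz : ∀ lam : Orbit P lam0, lam ≠ mu → (x * idem P lam) (Finsupp.single mu f) = 0 :=
      fun lam h => by rw [Module.End.mul_apply, idem_single_of_ne h.symm, map_zero]
    by_cases hmu : mu ∈ F
    · rw [Finset.sum_eq_single mu (fun lam _ h => hz lam h) (fun h => absurd hmu h),
        Module.End.mul_apply, idem_single]
    · rw [Finset.sum_eq_zero fun lam h => hz lam (by rintro rfl; exact hmu h)]
      have := LinearMap.congr_fun (hF mu hmu) (Finsupp.single mu f)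
      rwa [Module.End.mul_apply, idem_single] at this
  rw [hsum]
  exact sum_mem fun lam _ => hadm.mul_idem_mem hθ hω hred lam

end SimpleSystem

end QDHA

end

theorem mainTheorem7 {ι M N : Type*} [Finite ι]
    [AddCommGroup M] [Module ℝ M] [AddCommGroup N] [Module ℝ N]
    (P : RootPairing ι ℝ M N) [P.IsRootSystem] [P.IsCrystallographic] [P.IsIrreducible]
    (b : QDHA.SimpleSystem P) (θ : ι) (hθ : b.IsHighest θ)
    (lam0 : N) (ω : QDHA.Orbit P lam0 → ι × ℤ → ℤ) (hω : b.IsOrderFamily θ lam0 ω)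
    (red : QDHA.affineWeyl P → List (b.affSimple θ))
    (hred : ∀ w, b.IsReducedWord θ (red w) w) :
    LinearIndependent (QDHA.PolyFun M)
      (fun p : QDHA.Orbit P lam0 × QDHA.affineWeyl P =>
        b.tauWord θ ω (red p.2) * QDHA.idem P p.1) ∧
    (Submodule.span (QDHA.PolyFun M)
      (Set.range fun p : QDHA.Orbit P lam0 × QDHA.affineWeyl P =>
        b.tauWord θ ω (red p.2) * QDHA.idem P p.1) :
      Set (Module.End ℂ (QDHA.Pol P lam0))) = b.quiverDoubleHecke θ ω := by
  refine ⟨b.linearIndependent_tauWord hθ hω hred, Set.Subset.antisymm ?_ ?_⟩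
  · intro x hx
    induction hx using Submodule.span_induction with
    | mem x hx =>
      obtain ⟨p, rfl⟩ := hx
      exact b.tauWord_mul_idem_mem (red p.2) p.1
    | zero => exact zero_mem _
    | add x y _ _ hx hy => exact add_mem hx hy
    | smul f x _ hx => exact b.smul_mem_quiverDoubleHecke hx f
  · exact fun x hx => b.quiverDoubleHecke_le hθ hω hred hx
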